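/- Notation. $\Phi$ is the standard normal distribution function and $\phi$ its density. V-transforms. Let $F$ be an absolutely continuous, strictly increasing distribution function on $\mathbb R$, let $\mu\in\mathbb R$, and let $T_1,T_2$ be strictly increasing continuous functions on $[0,\infty)$ with $T_1(0)=T_2(0)$ and with the same range; put $g=T_2^{-1}\circ T_1$. The associated v-transform $\mathcal V:[0,1]\to[0,1]$ with fulcrum $\delta=F(\mu)$ is given by $$\mathcal V(u)=\begin{cases}F\bigl(\mu+g(\mu-F^{-1}(u))\bigr)-u, & 0<u\le\delta,\\ u-F\bigl(\mu-g^{-1}(F^{-1}(u)-\mu)\bigr), & \delta<u<1,\end{cases}$$ and $\mathcal V(0)=\mathcal V(1)=1$. Let $\mathcal V^{-1}(v)=\inf\{u\in[0,1]:\mathcal V(u)=v\}$ and $\Delta(v)=-1/\mathcal V'(\mathcal V^{-1}(v))$, where $\mathcal V'(\delta)$ is the left derivative and $\Delta(v)=0$ where the slope is $-\infty$ (the remaining points of non-differentiability of the left branch correspond to a null set of $v$, where any value may be used). The stochastic inversion function of $\mathcal V$ is $\boldsymbol{\mathcal V}^{-1}(v,w)=\mathcal V^{-1}(v)$ if $w\le\Delta(v)$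 and $\boldsymbol{\mathcal V}^{-1}(v,w)=v+\mathcal V^{-1}(v)$ if $w>\Delta(v)$. VT-ARMA copula processes. Let $(Z_t)_{t\in\mathbb Z}$ be a causal and invertible Gaussian ARMA$(p,q)$ process with mean zero and variance one, that is, $Z_t=\sum_{i=1}^p\varphi_iZ_{t-i}+\varepsilon_t+\sum_{j=1}^q\theta_j\varepsilon_{t-j}$ with $(\varepsilon_t)$ iid $N(0,\sigma^2)$, $\sigma^2>0$, where $Z_t=\sum_{j\ge0}\psi_j\varepsilon_{t-j}$ and $\varepsilon_t=\sum_{j\ge0}\pi_jZ_{t-j}$ almost surely for absolutely summable $(\psi_j)$ and $(\pi_j)$. Let $\rho(h)=\operatorname{Cov}(Z_0,Z_h)/\operatorname{Var}(Z_0)$ be its autocorrelation function. Let $(W_t)_{t\ge1}$ be iid uniform on $[0,1]$ and independent of $(Z_t)_{t\ge1}$, and let $U_t=\boldsymbol{\mathcal V}^{-1}(\Phi(Z_t),W_t)$ for $t=1,2,\dots$; $(U_t)_{t\ge1}$ is called a VT-ARMA copula process. Proposition. Let $(U_t)_{t\ge1}$ be a VT-ARMA copula process with v-transform $\mathcal V$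 and underlying ARMA$(p,q)$ process with autocorrelation function $\rho$. For every $k\in\mathbb N$ and all distinct $t_1,\dots,t_k\in\{1,2,\dots\}$, the matrix $P=P(t_1,\dots,t_k)=(\rho(|t_j-t_i|))_{i,j}$ is a positive definite correlation matrix, and the random vector $(U_{t_1},\dots,U_{t_k})$ has the joint density $$c^{\mathrm{Ga}}_{P}\bigl(\mathcal V(u_1),\dots,\mathcal V(u_k)\bigr),\qquad (u_1,\dots,u_k)\in[0,1]^k,$$ with respect to Lebesgue measure (and density zero outside $[0,1]^k$), where $c^{\mathrm{Ga}}_P(v_1,\dots,v_k)=f_P(\Phi^{-1}(v_1),\dots,\Phi^{-1}(v_k))/\prod_{i=1}^k\phi(\Phi^{-1}(v_i))$, with $f_P$ the density of $N(0,P)$, is the density of the Gaussian copula with correlation matrix $P$. In particular, $(U_t)_{t\ge1}$ is strictly stationary: for all $k$, all $t_1,\dots,t_k\ge1$ and all $h\ge1$, the vectors $(U_{t_1+h},\dots,U_{t_k+h})$ and $(U_{t_1},\dots,U_{t_k})$ have the same law. -/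

import Mathlib

open MeasureTheory ProbabilityTheory Set

noncomputable section

namespace VTArma

/-- The quantile function `F⁻¹(u) = inf {x : u ≤ F x}`. For a strictly increasing continuous
distribution function and `0 < u < 1` it is the ordinary inverse. -/
def quantile (F : ℝ → ℝ) (u : ℝ) : ℝ := sInf {x | u ≤ F x}

/-- The standard normal distribution function `Φ`. -/
def stdNormalCDF (x : ℝ) : ℝ := cdf (gaussianReal 0 1) x

/-! ### V-transforms -/

/-- The data of a volatility proxy transformation
`T x = T₁ (μ - x)` for `x ≤ μ`, `T x = T₂ (x - μ)` for `x > μ`.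
`T₁` and `T₂` have a common range, so that `T₂⁻¹ ∘ T₁` and its inverse are functions from
`[0, ∞)` to `[0, ∞)`. Differentiability of `T₁` and `T₂` is not required. -/
structure VolatilityProxy where
  /-- left branch -/
  T₁ : ℝ → ℝ
  /-- right branch -/
  T₂ : ℝ → ℝ
  /-- change point -/
  μ : ℝ
  strictMono_T₁ : StrictMonoOn T₁ (Ici 0)
  strictMono_T₂ : StrictMonoOn T₂ (Ici 0)
  continuous_T₁ : ContinuousOn T₁ (Ici 0)
  continuous_T₂ : ContinuousOn T₂ (Ici 0)
  map_zero : T₁ 0 = T₂ 0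
  range_eq : T₁ '' Ici 0 = T₂ '' Ici 0

/-- The profile function `g = T₂⁻¹ ∘ T₁` on `[0, ∞)`. -/
def VolatilityProxy.profile (T : VolatilityProxy) (x : ℝ) : ℝ :=
  Function.invFunOn T.T₂ (Ici 0) (T.T₁ x)

/-- The inverse profile function `g⁻¹ = T₁⁻¹ ∘ T₂` on `[0, ∞)`. -/
def VolatilityProxy.profileInv (T : VolatilityProxy) (x : ℝ) : ℝ :=
  Function.invFunOn T.T₁ (Ici 0) (T.T₂ x)

/-- The function `𝒱(u)`, `0 < u < 1`, built from a distribution function `F` and a volatility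
proxy transformation `T`. -/
def vFormula (F : ℝ → ℝ) (T : VolatilityProxy) (u : ℝ) : ℝ :=
  if u ≤ F T.μ then F (T.μ + T.profile (T.μ - quantile F u)) - u
  else u - F (T.μ - T.profileInv (quantile F u - T.μ))

/-- `V : [0, 1] → [0, 1]` is a v-transform with fulcrum `δ`: it is obtained from an absolutely
continuous, strictly increasing distribution function `F` on `ℝ` and a volatility proxy
transformation. At `u = 0` and `u = 1`, where `F⁻¹ u = ∓∞`, the construction gives the limiting
value `1`. Only the values of `V` on `[0, 1]` matter. -/
def IsVTransform (V : ℝ → ℝ) (δ : ℝ) : Prop :=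
  ∃ (ν : Measure ℝ) (T : VolatilityProxy), IsProbabilityMeasure ν ∧ ν ≪ volume ∧
    StrictMono (cdf ν) ∧ δ = cdf ν T.μ ∧ V 0 = 1 ∧ V 1 = 1 ∧
    ∀ u ∈ Ioo (0 : ℝ) 1, V u = vFormula (cdf ν) T u

/-- The inverse of the left branch of a v-transform, `𝒱⁻¹(v) = inf {u ∈ [0, 1] : 𝒱(u) = v}`. -/
def vInv (V : ℝ → ℝ) (v : ℝ) : ℝ := sInf {u | u ∈ Icc (0 : ℝ) 1 ∧ V u = v}

/-- The gradient of a v-transform on `[0, 1]`; at the fulcrum it is the left derivative. -/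
def vGradient (V : ℝ → ℝ) (δ u : ℝ) : ℝ :=
  if u = δ then derivWithin V (Icc 0 δ) δ else derivWithin V (Icc 0 1) u

/-- The conditional down probability `Δ(v) = -1 / 𝒱'(𝒱⁻¹(v))`. Where the left branch has slope
`-∞`, `derivWithin` is `0` and so `Δ(v) = 0`, which is the right value. The remaining points at
which the left branch is not differentiable correspond to a Lebesgue null set of `v`, since
`𝒱⁻¹` is Lipschitz. -/
def downProb (V : ℝ → ℝ) (δ v : ℝ) : ℝ := -1 / vGradient V δ (vInv V v)

/-- The stochastic inversion function of a v-transform. -/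
def stochInv (V : ℝ → ℝ) (δ v w : ℝ) : ℝ :=
  if w ≤ downProb V δ v then vInv V v else v + vInv V v

/-! ### Gaussian ARMA processes -/

variable {Ω : Type*} [MeasurableSpace Ω]

/-- `Z` is a causal and invertible Gaussian ARMA process of order `(p, q)` with mean zero:
`Z_t = ∑ φ_i Z_{t-i} + ε_t + ∑ θ_j ε_{t-j}` with iid `N(0, σ²)` innovations, `σ² > 0`, where
`Z_t = ∑_{j ≥ 0} ψ_j ε_{t-j}` and `ε_t = ∑_{j ≥ 0} π_j Z_{t-j}` for absolutely summable
coefficients. -/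
def IsCausalInvertibleGaussianARMA (P : Measure Ω) (p q : ℕ) (Z : ℤ → Ω → ℝ) : Prop :=
  (∀ t, Measurable (Z t)) ∧
  ∃ (φ : Fin p → ℝ) (θ : Fin q → ℝ) (ε : ℤ → Ω → ℝ) (σsq : NNReal),
    σsq ≠ 0 ∧ (∀ t, Measurable (ε t)) ∧ (∀ t, HasLaw (ε t) (gaussianReal 0 σsq) P) ∧
    iIndepFun ε P ∧
    (∀ t : ℤ, ∀ᵐ ω ∂P, Z t ω = ∑ i : Fin p, φ i * Z (t - ((i : ℕ) + 1)) ω + ε t ω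
      + ∑ j : Fin q, θ j * ε (t - ((j : ℕ) + 1)) ω) ∧
    (∃ ψ : ℕ → ℝ, Summable (fun j => |ψ j|) ∧
      ∀ t : ℤ, ∀ᵐ ω ∂P, HasSum (fun j : ℕ => ψ j * ε (t - j) ω) (Z t ω)) ∧
    (∃ π : ℕ → ℝ, Summable (fun j => |π j|) ∧
      ∀ t : ℤ, ∀ᵐ ω ∂P, HasSum (fun j : ℕ => π j * Z (t - j) ω) (ε t ω))

/-- The autocorrelation function `ρ(h) = Cov(Z_0, Z_h) / Var(Z_0)` of a stationary process. -/
def acf (P : Measure Ω) (Z : ℤ → Ω → ℝ) (h : ℕ) : ℝ :=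
  covariance (Z 0) (Z h) P / variance (Z 0) P

/-! ### VT-ARMA copula processes -/

/-- `U` (indexed by `t = 1, 2, …`) is a VT-ARMA copula process with v-transform `V` and underlying
ARMA(p, q) process `Z` of variance one: `U_t = 𝐕⁻¹(Φ(Z_t), W_t)` for iid standard uniform `W_t`
that are independent of `Z`. -/
def IsVTARMACopulaProcess (P : Measure Ω) (p q : ℕ) (Z : ℤ → Ω → ℝ) (V : ℝ → ℝ)
    (U : ℕ+ → Ω → ℝ) : Prop :=
  IsCausalInvertibleGaussianARMA P p q Z ∧ (∀ t, variance (Z t) P = 1) ∧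
  ∃ (δ : ℝ) (W : ℕ+ → Ω → ℝ), IsVTransform V δ ∧
    (∀ t, Measurable (W t)) ∧ (∀ t, HasLaw (W t) (volume.restrict (Icc (0 : ℝ) 1)) P) ∧
    iIndepFun W P ∧
    IndepFun (fun ω (t : ℕ+) => Z ((t : ℕ) : ℤ) ω) (fun ω (t : ℕ+) => W t ω) P ∧
    ∀ t ω, U t ω = stochInv V δ (stdNormalCDF (Z ((t : ℕ) : ℤ) ω)) (W t ω)

/-- Strict stationarity: the finite-dimensional distributions are invariant under time shifts. -/
def IsStrictlyStationary (P : Measure Ω) (U : ℕ+ → Ω → ℝ) : Prop :=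
  (∀ t, AEMeasurable (U t) P) ∧
  ∀ (k : ℕ) (t : Fin k → ℕ+) (h : ℕ+),
    P.map (fun ω i => U (t i + h) ω) = P.map (fun ω i => U (t i) ω)

/-! ### The Gaussian copula -/

/-- The matrix `P(t_1, …, t_k)` with entries `ρ(|t_j - t_i|)`. -/
def corrMatrix (ρ : ℕ → ℝ) {k : ℕ} (t : Fin k → ℕ+) : Matrix (Fin k) (Fin k) ℝ :=
  Matrix.of fun i j => ρ (((t j : ℕ) : ℤ) - ((t i : ℕ) : ℤ)).natAbs

/-- The density of the `k`-dimensional normal distribution with mean zero and covariance `R`. -/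
def mvNormalPDF {k : ℕ} (R : Matrix (Fin k) (Fin k) ℝ) (z : Fin k → ℝ) : ℝ :=
  Real.exp (-(z ⬝ᵥ (R⁻¹.mulVec z)) / 2) / Real.sqrt ((2 * Real.pi) ^ k * R.det)

/-- The density of the Gaussian copula `C_R^Ga`, the distribution function of
`(Φ(Y_1), …, Φ(Y_k))` for `Y ~ N(0, R)`, `R` a correlation matrix: the ratio of the joint density
of `Y` to the product of the marginal densities, at `Φ⁻¹(v_1), …, Φ⁻¹(v_k)`. -/
def gaussianCopulaDensity {k : ℕ} (R : Matrix (Fin k) (Fin k) ℝ) (v : Fin k → ℝ) : ℝ :=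
  mvNormalPDF R (fun i => quantile stdNormalCDF (v i)) /
    ∏ i, gaussianPDFReal 0 1 (quantile stdNormalCDF (v i))

end VTArma

end

/-! The proof is a change of measure. Suppose first that the `Z_{t_i}` were iid standard normal.
Then the pairs `(Φ(Z_{t_i}), W_{t_i})` are independent uniforms on the square, and stochastic
inversion sends each to a uniform variable (`map_stochInvDeriv`), so the vector `U` is uniform on
the cube (`map_pi_stochInvDeriv`). The true law of the `Z` vector has density `c(Φ(z_1), …, Φ(z_k))`
relative to that reference law, with `c` the Gaussian copula density (`withDensity_mvNormalPDF_eq`).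
Both branches of stochastic inversion satisfy `V(U_t) = Φ(Z_t)`, so this weight is the function
`c(V(u_1), …, V(u_k))` of the image point; it therefore survives the push-forward unchanged
(`map_withDensity_comp`) and is the density of `U`.

Uniformity needs no smoothness of `V`. The inverse `V⁻¹` of the left branch is decreasing while `v +
V⁻¹(v)` is increasing, hence `V⁻¹` is 1-Lipschitz. Almost everywhere `Δ = -(V⁻¹)'`, with values in
`[0, 1]`, and integrating `Δ` recovers `V⁻¹` (`integral_neg_deriv_vInvExt`), which yields the
distribution function of `U_t`.

On the ARMA side, causality makes the `Z` vector a limit of Gaussian vectors, hence Gaussian with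
shift-invariant covariances. Its covariance matrix is positive definite because the innovation at
the latest time is uncorrelated with every earlier `Z` (`integral_sq_pos`). -/

noncomputable section

namespace VTArma

/-! ### Limits of centred Gaussian variables -/

/-- An almost sure limit of centred real Gaussian variables is Gaussian. -/
theorem hasGaussianLaw_of_tendsto_ae_real {Ω : Type*} [MeasurableSpace Ω] {P : Measure Ω}
    [IsProbabilityMeasure P] {X : ℕ → Ω → ℝ} {Y : Ω → ℝ}
    (hX : ∀ n, HasGaussianLaw (X n) P) (hmean : ∀ n, ∫ ω, X n ω ∂P = 0)
    (hY : AEMeasurable Y P)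
    (hlim : ∀ᵐ ω ∂P, Filter.Tendsto (fun n => X n ω) Filter.atTop (nhds (Y ω))) :
    HasGaussianLaw Y P := by
  have hPY : IsProbabilityMeasure (P.map Y) := Measure.isProbabilityMeasure_map hY
  have hchar : ∀ s : ℝ, Filter.Tendsto
      (fun n => ((Real.exp (-(Var[X n; P] * s ^ 2 / 2)) : ℝ) : ℂ)) Filter.atTop
      (nhds (charFun (P.map Y) s)) := by
    intro s
    have h1 : Filter.Tendsto (fun n => ∫ ω, Complex.exp (s * X n ω * Complex.I) ∂P)
        Filter.atTop (nhds (∫ ω, Complex.exp (s * Y ω * Complex.I) ∂P)) := by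
      refine tendsto_integral_filter_of_norm_le_const ?_ ⟨1, ?_⟩ ?_
      · refine Filter.Eventually.of_forall fun n => ?_
        have := (hX n).aemeasurable
        exact AEMeasurable.aestronglyMeasurable (by fun_prop)
      · refine Filter.Eventually.of_forall fun n => Filter.Eventually.of_forall fun ω => ?_
        rw [← Complex.ofReal_mul, Complex.norm_exp_ofReal_mul_I]
      · filter_upwards [hlim] with ω hω
        have : Continuous fun x : ℝ => Complex.exp (s * x * Complex.I) := by fun_prop
        exact (this.tendsto _).comp hω
    have h2 : ∀ n, ∫ ω, Complex.exp (s * X n ω * Complex.I) ∂P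
        = ((Real.exp (-(Var[X n; P] * s ^ 2 / 2)) : ℝ) : ℂ) := by
      intro n
      have := charFun_gaussianReal (μ := ∫ ω, X n ω ∂P) (v := Var[X n; P].toNNReal) s
      rw [← (hX n).map_eq_gaussianReal, charFun_apply_real, hmean n,
        integral_map (hX n).aemeasurable (by fun_prop)] at this
      rw [this, Real.coe_toNNReal _ (variance_nonneg _ _)]
      push_cast
      congr 1
      ring
    have h3 : charFun (P.map Y) s = ∫ ω, Complex.exp (s * Y ω * Complex.I) ∂P := by
      rw [charFun_apply_real, integral_map hY (by fun_prop)]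
    rw [h3]
    exact h1.congr h2
  -- Convergence of the variances is not known yet. The limit `r` of `exp(-Var/2)` replaces it: the
  -- limiting characteristic function is `r ^ (s ^ 2)`, and once `r > 0` the limiting variance is
  -- `-2 log r`.
  set r : ℝ := (charFun (P.map Y) 1).re with hr
  have hr1 : Filter.Tendsto (fun n => Real.exp (-(Var[X n; P] / 2))) Filter.atTop (nhds r) := by
    have := (Complex.continuous_re.tendsto _).comp (hchar 1)
    refine this.congr fun n => ?_
    simp only [Function.comp_apply, Complex.ofReal_re]
    norm_num
  have hr0 : 0 ≤ r := ge_of_tendsto' hr1 fun n => (Real.exp_pos _).le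
  have hrle : r ≤ 1 := le_of_tendsto' hr1 fun n => by
    rw [Real.exp_le_one_iff]
    have := variance_nonneg (X n) P
    linarith
  have hpow : ∀ s : ℝ, s ≠ 0 → charFun (P.map Y) s = ((r ^ (s ^ 2) : ℝ) : ℂ) := by
    intro s hs
    have h1 := (hr1.rpow_const (p := s ^ 2) (Or.inr (by positivity)))
    refine tendsto_nhds_unique (hchar s) (((Complex.continuous_ofReal.tendsto _).comp h1).congr ?_)
    intro n
    simp only [Function.comp_apply]
    rw [← Real.exp_mul]
    congr 2
    ring
  -- Escaping variances would give a characteristic function vanishing off `0` but equal to `1` at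
  -- `0`, against continuity.
  have hrpos : 0 < r := by
    rcases hr0.lt_or_eq with h | h
    · exact h
    exfalso
    have hz : ∀ s : ℝ, s ≠ 0 → charFun (P.map Y) s = 0 := by
      intro s hs
      rw [hpow s hs, ← h, Real.zero_rpow (by positivity)]
      simp
    have hcont : Filter.Tendsto (charFun (P.map Y)) (nhdsWithin 0 {(0 : ℝ)}ᶜ)
        (nhds (charFun (P.map Y) 0)) :=
      ((continuous_charFun (μ := P.map Y)).tendsto 0).mono_left nhdsWithin_le_nhds
    have h0 : Filter.Tendsto (charFun (P.map Y)) (nhdsWithin 0 {(0 : ℝ)}ᶜ) (nhds 0) := by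
      refine tendsto_const_nhds.congr' ?_
      filter_upwards [self_mem_nhdsWithin] with s hs
      exact (hz s hs).symm
    have := tendsto_nhds_unique hcont h0
    simp at this
  have hmap : P.map Y = gaussianReal 0 (-2 * Real.log r).toNNReal := by
    apply Measure.ext_of_charFun
    ext s
    rw [charFun_gaussianReal, Real.coe_toNNReal]
    · rcases eq_or_ne s 0 with rfl | hs
      · simp
      · rw [hpow s hs, Real.rpow_def_of_pos hrpos, Complex.ofReal_exp]
        congr 1
        push_cast
        ring
    · have := Real.log_nonpos hr0 hrle
      linarith
  exact ⟨by rw [hmap]; infer_instance⟩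

/-- An almost sure limit of centred Gaussian vectors is Gaussian. -/
theorem hasGaussianLaw_of_tendsto_ae {Ω : Type*} [MeasurableSpace Ω] {P : Measure Ω}
    [IsProbabilityMeasure P] {E : Type*} [NormedAddCommGroup E] [NormedSpace ℝ E]
    [MeasurableSpace E] [BorelSpace E] [CompleteSpace E] [SecondCountableTopology E]
    {X : ℕ → Ω → E} {Y : Ω → E}
    (hX : ∀ n, HasGaussianLaw (X n) P) (hmean : ∀ n, ∫ ω, X n ω ∂P = 0)
    (hY : AEMeasurable Y P)
    (hlim : ∀ᵐ ω ∂P, Filter.Tendsto (fun n => X n ω) Filter.atTop (nhds (Y ω))) :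
    HasGaussianLaw Y P := by
  refine ⟨isGaussian_of_isGaussian_map fun L => ?_⟩
  rw [AEMeasurable.map_map_of_aemeasurable (by fun_prop) hY]
  refine (hasGaussianLaw_of_tendsto_ae_real (X := fun n ω => L (X n ω)) (Y := L ∘ Y)
    (fun n => (hX n).map_fun L) (fun n => ?_) (by fun_prop) ?_).isGaussian_map
  · rw [L.integral_comp_comm (hX n).integrable, hmean n, map_zero]
  · filter_upwards [hlim] with ω hω
    exact (L.continuous.tendsto _).comp hω

/-! ### Second order structure of a causal linear process -/

section LinearProcess

variable {Ω : Type*} [MeasurableSpace Ω] {P : Measure Ω}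
  {ε Z : ℤ → Ω → ℝ} {σsq : NNReal} {ψ : ℕ → ℝ}

/-- The coefficients of a causal filter, extended by zero to negative lags. -/
def causalCoeff (ψ : ℕ → ℝ) (m : ℤ) : ℝ := if 0 ≤ m then ψ m.toNat else 0

theorem hasGaussianLaw_innovation (hlaw : ∀ t, HasLaw (ε t) (gaussianReal 0 σsq) P) (t : ℤ) :
    HasGaussianLaw (ε t) P := (hlaw t).hasGaussianLaw

theorem integral_innovation (hlaw : ∀ t, HasLaw (ε t) (gaussianReal 0 σsq) P) (t : ℤ) :
    ∫ ω, ε t ω ∂P = 0 := by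
  rw [(hlaw t).integral_eq]
  simp

theorem integral_innovation_mul [IsProbabilityMeasure P]
    (hlaw : ∀ t, HasLaw (ε t) (gaussianReal 0 σsq) P)
    (hind : iIndepFun ε P) (s t : ℤ) :
    ∫ ω, ε s ω * ε t ω ∂P = if s = t then (σsq : ℝ) else 0 := by
  have hL : ∀ t, MemLp (ε t) 2 P := fun t => (hasGaussianLaw_innovation hlaw t).memLp_two
  have hcov : cov[ε s, ε t; P] = ∫ ω, ε s ω * ε t ω ∂P := by
    rw [covariance_eq_sub (hL s) (hL t), integral_innovation hlaw s]
    simp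
  rw [← hcov]
  split_ifs with h
  · subst h
    rw [covariance_self (hL s).aemeasurable, (hlaw s).variance_eq]
    simp
  · exact (hind.indepFun h).covariance_eq_zero (hL s) (hL t)

/-- Term by term integration of a causal series against a square integrable variable. -/
theorem hasSum_integral_causal_mul (hlaw : ∀ t, HasLaw (ε t) (gaussianReal 0 σsq) P)
    (hψ : Summable fun j => |ψ j|)
    (hZ : ∀ t : ℤ, ∀ᵐ ω ∂P, HasSum (fun j : ℕ => ψ j * ε (t - j) ω) (Z t ω))
    {W : Ω → ℝ} (hW : MemLp W 2 P) (t : ℤ) :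
    HasSum (fun j : ℕ => ψ j * ∫ ω, ε (t - j) ω * W ω ∂P) (∫ ω, Z t ω * W ω ∂P) := by
  have hL : ∀ t, MemLp (ε t) 2 P := fun t => (hasGaussianLaw_innovation hlaw t).memLp_two
  have hint : ∀ s, Integrable (fun ω => ε s ω * W ω) P := fun s => (hL s).integrable_mul hW
  have hsq : ∀ s, ∫ ω, ε s ω ^ 2 ∂P = σsq := by
    intro s
    have h := variance_of_integral_eq_zero (hL s).aemeasurable (integral_innovation hlaw s)
    rw [(hlaw s).variance_eq] at h
    simpa using h.symm
  -- From `|ab| ≤ a² + b²`. The bound does not depend on `s`, so summability of `|ψ j|` alone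
  -- justifies exchanging sum and integral.
  have hbound : ∀ s, ∫ ω, ‖ε s ω * W ω‖ ∂P ≤ σsq + ∫ ω, W ω ^ 2 ∂P := by
    intro s
    rw [← hsq s, ← integral_add (hL s).integrable_sq hW.integrable_sq]
    refine integral_mono (hint s).norm ((hL s).integrable_sq.add hW.integrable_sq) fun ω => ?_
    simp only [norm_mul, Real.norm_eq_abs]
    nlinarith [sq_nonneg (|ε s ω| - |W ω|), sq_abs (ε s ω), sq_abs (W ω), sq_nonneg (ε s ω),
      sq_nonneg (W ω)]
  have key := hasSum_integral_of_summable_integral_norm (μ := P)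
    (F := fun (j : ℕ) ω => ψ j * (ε (t - j) ω * W ω)) (fun j => (hint _).const_mul _) ?_
  · have heq : ∫ ω, ∑' j : ℕ, ψ j * (ε (t - j) ω * W ω) ∂P = ∫ ω, Z t ω * W ω ∂P := by
      refine integral_congr_ae ?_
      filter_upwards [hZ t] with ω hω
      rw [← (hω.mul_right (W ω)).tsum_eq]
      simp only [mul_assoc]
    rw [heq] at key
    simpa only [integral_const_mul] using key
  · refine Summable.of_nonneg_of_le (fun j => integral_nonneg fun ω => norm_nonneg _)
      (fun j => ?_) (hψ.mul_right (σsq + ∫ ω, W ω ^ 2 ∂P))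
    simp only [norm_mul (ψ j), Real.norm_eq_abs (ψ j), integral_const_mul]
    exact mul_le_mul_of_nonneg_left (hbound _) (abs_nonneg _)

variable [IsProbabilityMeasure P]

theorem integral_causal (hlaw : ∀ t, HasLaw (ε t) (gaussianReal 0 σsq) P)
    (hψ : Summable fun j => |ψ j|)
    (hZ : ∀ t : ℤ, ∀ᵐ ω ∂P, HasSum (fun j : ℕ => ψ j * ε (t - j) ω) (Z t ω)) (t : ℤ) :
    ∫ ω, Z t ω ∂P = 0 := by
  have h := hasSum_integral_causal_mul hlaw hψ hZ (W := fun _ => 1) (memLp_const 1) t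
  simp only [mul_one, integral_innovation hlaw, mul_zero] at h
  exact h.unique hasSum_zero

/-- Only the term `j = t - s` survives; for `s > t` there is none, so future innovations are
uncorrelated with `Z t`. -/
theorem integral_causal_mul_innovation (hlaw : ∀ t, HasLaw (ε t) (gaussianReal 0 σsq) P)
    (hind : iIndepFun ε P) (hψ : Summable fun j => |ψ j|)
    (hZ : ∀ t : ℤ, ∀ᵐ ω ∂P, HasSum (fun j : ℕ => ψ j * ε (t - j) ω) (Z t ω)) (t s : ℤ) :
    ∫ ω, Z t ω * ε s ω ∂P = causalCoeff ψ (t - s) * σsq := by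
  have h := hasSum_integral_causal_mul hlaw hψ hZ
    (hasGaussianLaw_innovation hlaw s).memLp_two t
  simp only [integral_innovation_mul hlaw hind] at h
  refine h.unique ?_
  unfold causalCoeff
  split_ifs with hts
  · have h1 := hasSum_single (f := fun j : ℕ => ψ j * if t - j = s then (σsq : ℝ) else 0)
      (t - s).toNat fun j hj => by rw [if_neg (by omega), mul_zero]
    rwa [if_pos (by omega)] at h1
  · convert! hasSum_zero using 1
    · ext j
      rw [if_neg (by omega), mul_zero]
    · simp

/-- Expanding `Z t` alone gives a series whose terms involve the two times only through `s - t`. -/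
theorem integral_causal_mul_causal_shift (hlaw : ∀ t, HasLaw (ε t) (gaussianReal 0 σsq) P)
    (hind : iIndepFun ε P) (hψ : Summable fun j => |ψ j|)
    (hZ : ∀ t : ℤ, ∀ᵐ ω ∂P, HasSum (fun j : ℕ => ψ j * ε (t - j) ω) (Z t ω))
    (hL : ∀ t, MemLp (Z t) 2 P) (t s h : ℤ) :
    ∫ ω, Z (t + h) ω * Z (s + h) ω ∂P = ∫ ω, Z t ω * Z s ω ∂P := by
  have hs : ∀ t s : ℤ, HasSum (fun j : ℕ => ψ j * (causalCoeff ψ (s - (t - j)) * σsq))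
      (∫ ω, Z t ω * Z s ω ∂P) := by
    intro t s
    have h := hasSum_integral_causal_mul hlaw hψ hZ (hL s) t
    simpa only [mul_comm (ε _ _), integral_causal_mul_innovation hlaw hind hψ hZ] using h
  refine (hs (t + h) (s + h)).unique ?_
  convert! hs t s using 5
  ring

theorem hasGaussianLaw_causal_pi (hlaw : ∀ t, HasLaw (ε t) (gaussianReal 0 σsq) P)
    (hind : iIndepFun ε P)
    (hZ : ∀ t : ℤ, ∀ᵐ ω ∂P, HasSum (fun j : ℕ => ψ j * ε (t - j) ω) (Z t ω))
    (hmeas : ∀ t, Measurable (Z t)) {ι : Type*} [Fintype ι] (t : ι → ℤ) :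
    HasGaussianLaw (fun ω i => Z (t i) ω) P := by
  have hg : ∀ n, HasGaussianLaw
      (fun ω i => ∑ j : Fin n, ψ j * ε (t i - (j : ℕ)) ω) P := by
    intro n
    classical
    -- The truncated sums at different `t i` may share innovations. Collecting the innovation times
    -- in a set keeps them distinct, so the innovations indexed by `S` are jointly Gaussian and the
    -- truncations are a linear image of them.
    let S : Finset ℤ := Finset.image (fun x : ι × Fin n => t x.1 - (x.2 : ℕ)) Finset.univ
    have hS : ∀ i (j : Fin n), t i - (j : ℕ) ∈ S := fun i j =>
      Finset.mem_image_of_mem (fun x : ι × Fin n => t x.1 - (x.2 : ℕ)) (Finset.mem_univ (i, j))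
    have h1 : HasGaussianLaw (fun ω (s : S) => ε s ω) P :=
      iIndepFun.hasGaussianLaw (fun s => hasGaussianLaw_innovation hlaw _)
        (hind.precomp Subtype.val_injective)
    let A : (S → ℝ) →L[ℝ] (ι → ℝ) := ContinuousLinearMap.pi fun i =>
      ∑ j : Fin n, ψ j • ContinuousLinearMap.proj (R := ℝ) (φ := fun _ : S => ℝ) ⟨_, hS i j⟩
    convert! h1.map_fun A using 1
    ext ω i
    simp [A]
  refine hasGaussianLaw_of_tendsto_ae hg (fun n => ?_)
    (measurable_pi_lambda _ fun i => hmeas _).aemeasurable ?_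
  · ext i
    rw [eval_integral fun i => ((hg n).eval i).integrable, integral_finsetSum]
    · simp [integral_const_mul, integral_innovation hlaw]
    · intro j _
      exact (hasGaussianLaw_innovation hlaw _).integrable.const_mul _
  · have : ∀ᵐ ω ∂P, ∀ i, HasSum (fun j : ℕ => ψ j * ε (t i - j) ω) (Z (t i) ω) :=
      ae_all_iff.2 fun i => hZ (t i)
    filter_upwards [this] with ω hω
    refine tendsto_pi_nhds.2 fun i => ?_
    refine (hω i).tendsto_sum_nat.congr fun n => ?_
    rw [Finset.sum_range]

end LinearProcess

/-! ### Correlations of an ARMA process -/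

section ARMA

variable {Ω : Type*} [MeasurableSpace Ω] {P : Measure Ω} [IsProbabilityMeasure P] {p q : ℕ}
  {Z : ℤ → Ω → ℝ}

theorem IsCausalInvertibleGaussianARMA.hasGaussianLaw
    (hZ : IsCausalInvertibleGaussianARMA P p q Z) {ι : Type*} [Fintype ι] (t : ι → ℤ) :
    HasGaussianLaw (fun ω i => Z (t i) ω) P := by
  obtain ⟨hm, φ, θ, ε, σsq, hσ, hεm, hlaw, hind, harma, ⟨ψ, hψ, hsum⟩, -⟩ := hZ
  exact hasGaussianLaw_causal_pi hlaw hind hsum hm t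

theorem IsCausalInvertibleGaussianARMA.memLp_two
    (hZ : IsCausalInvertibleGaussianARMA P p q Z) (t : ℤ) : MemLp (Z t) 2 P :=
  ((hZ.hasGaussianLaw fun _ : Unit => t).eval ()).memLp_two

theorem IsCausalInvertibleGaussianARMA.integral_eq_zero
    (hZ : IsCausalInvertibleGaussianARMA P p q Z) (t : ℤ) : ∫ ω, Z t ω ∂P = 0 := by
  obtain ⟨hm, φ, θ, ε, σsq, hσ, hεm, hlaw, hind, harma, ⟨ψ, hψ, hsum⟩, -⟩ := hZ
  exact integral_causal hlaw hψ hsum t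

theorem IsCausalInvertibleGaussianARMA.covariance_eq_integral
    (hZ : IsCausalInvertibleGaussianARMA P p q Z) (s t : ℤ) :
    cov[Z s, Z t; P] = ∫ ω, Z s ω * Z t ω ∂P := by
  rw [covariance_eq_sub (hZ.memLp_two s) (hZ.memLp_two t), hZ.integral_eq_zero]
  simp

theorem IsCausalInvertibleGaussianARMA.covariance_shift
    (hZ : IsCausalInvertibleGaussianARMA P p q Z) (s t h : ℤ) :
    cov[Z (s + h), Z (t + h); P] = cov[Z s, Z t; P] := by
  rw [hZ.covariance_eq_integral, hZ.covariance_eq_integral]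
  have hL := hZ.memLp_two
  obtain ⟨hm, φ, θ, ε, σsq, hσ, hεm, hlaw, hind, harma, ⟨ψ, hψ, hsum⟩, -⟩ := hZ
  exact integral_causal_mul_causal_shift hlaw hind hψ hsum hL s t h

/-- Nontrivial linear combinations of an ARMA process are nondegenerate. -/
theorem IsCausalInvertibleGaussianARMA.integral_sq_pos
    (hZ : IsCausalInvertibleGaussianARMA P p q Z) {ι : Type*} [Fintype ι] {t : ι → ℤ}
    (ht : Function.Injective t) {a : ι → ℝ} (ha : a ≠ 0) :
    0 < ∫ ω, (∑ i, a i * Z (t i) ω) ^ 2 ∂P := by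
  have hL := hZ.memLp_two
  obtain ⟨hm, φ, θ, ε, σsq, hσ, hεm, hlaw, hind, harma, ⟨ψ, hψ, hsum⟩, -⟩ := hZ
  have hεL : ∀ t, MemLp (ε t) 2 P := fun t => (hasGaussianLaw_innovation hlaw t).memLp_two
  have hZε := integral_causal_mul_innovation hlaw hind hψ hsum
  have hfut : ∀ s t : ℤ, s < t → ∫ ω, Z s ω * ε t ω ∂P = 0 := by
    intro s t hst
    rw [hZε, causalCoeff, if_neg (by omega), zero_mul]
  -- Multiplying the ARMA equation by `ε t` and integrating leaves only the `ε t` squared term; this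
  -- replaces a proof that `ψ 0 = 1`.
  have hnow : ∀ t : ℤ, ∫ ω, Z t ω * ε t ω ∂P = σsq := by
    intro t
    have h1 : ∫ ω, Z t ω * ε t ω ∂P
        = ∫ ω, (∑ i : Fin p, φ i * (Z (t - ((i : ℕ) + 1)) ω * ε t ω)) + ε t ω * ε t ω
          + ∑ j : Fin q, θ j * (ε (t - ((j : ℕ) + 1)) ω * ε t ω) ∂P := by
      refine integral_congr_ae ?_
      filter_upwards [harma t] with ω hω
      rw [hω, add_mul, add_mul, Finset.sum_mul, Finset.sum_mul]
      simp only [mul_assoc]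
    have i1 : ∀ i : Fin p,
        Integrable (fun ω => φ i * (Z (t - ((i : ℕ) + 1)) ω * ε t ω)) P :=
      fun i => ((hL _).integrable_mul (hεL t)).const_mul _
    have i2 : ∀ j : Fin q,
        Integrable (fun ω => θ j * (ε (t - ((j : ℕ) + 1)) ω * ε t ω)) P :=
      fun i => ((hεL _).integrable_mul (hεL t)).const_mul _
    have i3 : Integrable (fun ω => ε t ω * ε t ω) P := (hεL t).integrable_mul (hεL t)
    have i4 : Integrable (fun ω => ∑ i : Fin p, φ i * (Z (t - ((i : ℕ) + 1)) ω * ε t ω)) P :=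
      integrable_finsetSum _ fun i _ => i1 i
    have i5 : Integrable (fun ω => ∑ j : Fin q, θ j * (ε (t - ((j : ℕ) + 1)) ω * ε t ω)) P :=
      integrable_finsetSum _ fun i _ => i2 i
    rw [h1, integral_add (by exact i4.add i3) i5, integral_add i4 i3,
      integral_finsetSum _ fun i _ => i1 i, integral_finsetSum _ fun i _ => i2 i]
    simp only [integral_const_mul, integral_innovation_mul hlaw hind]
    rw [Finset.sum_eq_zero, Finset.sum_eq_zero]
    · simp
    · intro j _
      rw [if_neg (by omega), mul_zero]
    · intro i _
      rw [hfut _ _ (by omega), mul_zero]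
  have hXL : MemLp (fun ω => ∑ i, a i * Z (t i) ω) 2 P :=
    memLp_finsetSum _ fun i _ => (hL (t i)).const_mul (a i)
  refine lt_of_le_of_ne (integral_nonneg fun ω => sq_nonneg _) fun h0 => ?_
  have hX0 : (fun ω => ∑ i, a i * Z (t i) ω) =ᵐ[P] 0 := by
    have := (integral_eq_zero_iff_of_nonneg (fun ω => sq_nonneg _) hXL.integrable_sq).1 h0.symm
    filter_upwards [this] with ω hω
    simpa using hω
  obtain ⟨i₁, hi₁⟩ : ∃ i, a i ≠ 0 := by
    by_contra! h
    exact ha (funext h)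
  classical
  -- Let `t m` be the latest time with a nonzero coefficient. Pairing the combination with `ε (t m)`
  -- gives `a m * σsq ≠ 0`, whereas an almost surely zero combination would pair to `0`.
  obtain ⟨m, hm1, hmax⟩ := Finset.exists_max_image (Finset.univ.filter fun i => a i ≠ 0) t
    ⟨i₁, by simp [hi₁]⟩
  have hz : ∫ ω, (∑ i, a i * Z (t i) ω) * ε (t m) ω ∂P = 0 := by
    rw [integral_eq_zero_of_ae]
    filter_upwards [hX0] with ω hω
    simp only [Pi.zero_apply] at hω ⊢
    rw [hω, zero_mul]
  have hc : ∫ ω, (∑ i, a i * Z (t i) ω) * ε (t m) ω ∂P = a m * σsq := by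
    simp only [Finset.sum_mul, mul_assoc]
    have hI : ∀ i, Integrable (fun ω => a i * (Z (t i) ω * ε (t m) ω)) P := fun i =>
      ((hL _).integrable_mul (hεL (t m))).const_mul (a i)
    rw [integral_finsetSum _ fun i _ => hI i, Finset.sum_eq_single m]
    · rw [integral_const_mul]
      simp only [hnow]
    · intro i _ him
      rw [integral_const_mul]
      rcases eq_or_ne (a i) 0 with h | h
      · rw [h, zero_mul]
      · have hle := hmax i (by simp [h])
        have hne : t i ≠ t m := fun h => him (ht h)
        rw [show ∫ ω, Z (t i) ω * ε (t m) ω ∂P = 0 from hfut _ _ (lt_of_le_of_ne hle hne),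
          mul_zero]
    · simp
  rw [hc] at hz
  have : (σsq : ℝ) ≠ 0 := by exact_mod_cast hσ
  have ham : a m ≠ 0 := by simpa using hm1
  exact mul_ne_zero ham this hz

theorem IsCausalInvertibleGaussianARMA.corrMatrix_apply
    (hZ : IsCausalInvertibleGaussianARMA P p q Z) (hvar : ∀ t, Var[Z t; P] = 1)
    {k : ℕ} (t : Fin k → ℕ+) (i j : Fin k) :
    corrMatrix (acf P Z) t i j = cov[Z (t i : ℕ), Z (t j : ℕ); P] := by
  have key : ∀ s u : ℕ, s ≤ u →
      acf P Z (((u : ℕ) : ℤ) - ((s : ℕ) : ℤ)).natAbs = cov[Z s, Z u; P] := by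
    intro s u hsu
    rw [acf, hvar, div_one]
    have := hZ.covariance_shift 0 ((((u : ℕ) : ℤ) - ((s : ℕ) : ℤ)).natAbs) s
    rw [← this]
    congr 2
    · ring
    · omega
  simp only [corrMatrix, Matrix.of_apply]
  rcases le_total (t i : ℕ) (t j : ℕ) with h | h
  · exact key _ _ h
  · rw [covariance_comm, ← key _ _ h, ← Int.natAbs_neg, neg_sub]

/-- The quadratic form at `x` is the variance of `∑ i, x i * Z (t i)`, which `integral_sq_pos` makes
positive. -/
theorem IsCausalInvertibleGaussianARMA.posDef_corrMatrix
    (hZ : IsCausalInvertibleGaussianARMA P p q Z) (hvar : ∀ t, Var[Z t; P] = 1)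
    {k : ℕ} {t : Fin k → ℕ+} (ht : Function.Injective t) :
    (corrMatrix (acf P Z) t).PosDef := by
  refine Matrix.PosDef.of_dotProduct_mulVec_pos ?_ fun x hx => ?_
  · ext i j
    simp only [Matrix.conjTranspose_apply, star_trivial, hZ.corrMatrix_apply hvar]
    exact covariance_comm _ _
  · have hinj : Function.Injective fun i => ((t i : ℕ) : ℤ) := fun i j h => by
      apply ht
      simpa using h
    have := hZ.integral_sq_pos hinj hx
    convert! this using 1
    have hL : ∀ i, MemLp (fun ω => x i * Z (t i : ℕ) ω) 2 P := fun i =>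
      (hZ.memLp_two _).const_mul (x i)
    rw [← variance_of_integral_eq_zero (X := fun ω => ∑ i, x i * Z (t i : ℕ) ω)
      (memLp_finsetSum _ fun i _ => hL i).aemeasurable, variance_fun_sum hL]
    · simp only [dotProduct, Matrix.mulVec, Finset.mul_sum, hZ.corrMatrix_apply hvar,
        covariance_const_mul_left, covariance_const_mul_right, star_trivial, Pi.star_apply]
      refine Finset.sum_congr rfl fun i _ => Finset.sum_congr rfl fun j _ => ?_
      ring
    · rw [integral_finsetSum _ fun i _ => (hL i).integrable (by norm_num)]
      simp [integral_const_mul, hZ.integral_eq_zero]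

theorem IsCausalInvertibleGaussianARMA.corrMatrix_diag
    (hZ : IsCausalInvertibleGaussianARMA P p q Z) (hvar : ∀ t, Var[Z t; P] = 1)
    {k : ℕ} (t : Fin k → ℕ+) (i : Fin k) : corrMatrix (acf P Z) t i i = 1 := by
  rw [hZ.corrMatrix_apply hvar, covariance_self (hZ.memLp_two _).aemeasurable, hvar]

end ARMA

/-- A weight that depends on `x` only through `f x` commutes with the push-forward along `f`. This
is the change-of-measure step of the main argument. -/
theorem map_withDensity_comp {α β : Type*} [MeasurableSpace α] [MeasurableSpace β]
    {μ : Measure α} {f : α → β} {g : β → ENNReal} (hf : Measurable f) (hg : Measurable g) :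
    (μ.withDensity fun x => g (f x)).map f = (μ.map f).withDensity g := by
  ext s hs
  rw [Measure.map_apply hf hs, withDensity_apply _ (hf hs), withDensity_apply _ hs,
    setLIntegral_map hs hg hf]

/-! ### Densities of multivariate normal distributions -/

theorem pi_gaussianReal_eq_withDensity (k : ℕ) :
    Measure.pi (fun _ : Fin k => gaussianReal 0 1) =
      (volume : Measure (Fin k → ℝ)).withDensity
        fun x => ENNReal.ofReal (∏ i, gaussianPDFReal 0 1 (x i)) := by
  refine Measure.pi_eq fun s hs => ?_
  have hint : Integrable (fun x : Fin k → ℝ => ∏ i, gaussianPDFReal 0 1 (x i)) :=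
    Integrable.fintype_prod fun _ => integrable_gaussianPDFReal 0 1
  rw [withDensity_apply _ (MeasurableSet.univ_pi hs), ← ofReal_integral_eq_lintegral_ofReal
    hint.integrableOn (Filter.Eventually.of_forall fun x =>
      Finset.prod_nonneg fun i _ => gaussianPDFReal_nonneg _ _ _), volume_pi,
    Measure.restrict_pi_pi, integral_fintype_prod_eq_prod, ENNReal.ofReal_prod_of_nonneg]
  · refine Finset.prod_congr rfl fun i _ => ?_
    rw [gaussianReal_apply_eq_integral _ one_ne_zero]
  · exact fun i _ => integral_nonneg fun x => gaussianPDFReal_nonneg _ _ _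

theorem measurable_mvNormalPDF {k : ℕ} (R : Matrix (Fin k) (Fin k) ℝ) :
    Measurable (mvNormalPDF R) := by
  have h : Continuous fun z : Fin k → ℝ => z ⬝ᵥ (R⁻¹.mulVec z) := by fun_prop
  unfold mvNormalPDF
  have := h.measurable
  fun_prop

theorem prod_gaussianPDFReal {k : ℕ} (x : Fin k → ℝ) :
    ∏ i, gaussianPDFReal 0 1 (x i)
      = Real.exp (-(x ⬝ᵥ x) / 2) / Real.sqrt ((2 * Real.pi) ^ k) := by
  simp only [gaussianPDFReal, NNReal.coe_one, mul_one, sub_zero, Finset.prod_mul_distrib,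
    Finset.prod_const, Finset.card_univ, Fintype.card_fin, ← Real.exp_sum]
  rw [Real.sqrt_eq_rpow, Real.sqrt_eq_rpow, ← Real.rpow_natCast_mul (by positivity),
    mul_comm (k : ℝ), Real.rpow_mul_natCast (by positivity), inv_pow, mul_comm, div_eq_mul_inv]
  congr 2
  rw [← Finset.sum_div, Finset.sum_neg_distrib]
  simp [dotProduct, sq]

/-- The standard density at `x` is a function of `A x` through `A⁻¹`. The Jacobian `|det A|⁻¹`
supplies the root of `det (A Aᵀ)`, and the squared norm of `A⁻¹ z` is the quadratic form of `(A
Aᵀ)⁻¹`. -/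
theorem map_pi_gaussianReal_toLin' {k : ℕ} {A : Matrix (Fin k) (Fin k) ℝ} (hA : A.det ≠ 0) :
    (Measure.pi (fun _ : Fin k => gaussianReal 0 1)).map (Matrix.toLin' A) =
      volume.withDensity fun z => ENNReal.ofReal (mvNormalPDF (A * A.transpose) z) := by
  have hunit : IsUnit A.det := isUnit_iff_ne_zero.2 hA
  have hg : Measurable fun z : Fin k → ℝ =>
      ENNReal.ofReal (∏ i, gaussianPDFReal 0 1 (A⁻¹.mulVec z i)) := by
    have h : Continuous fun z : Fin k → ℝ => A⁻¹.mulVec z := by fun_prop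
    have := h.measurable
    have h2 : ∀ i, Measurable fun z : Fin k → ℝ => A⁻¹.mulVec z i := fun i => by fun_prop
    refine ENNReal.measurable_ofReal.comp (Finset.measurable_fun_prod _ fun i _ => ?_)
    exact (measurable_gaussianPDFReal 0 1).comp (h2 i)
  have hm : Measurable (Matrix.toLin' A) :=
    (LinearMap.continuous_of_finiteDimensional (Matrix.toLin' A)).measurable
  have hcomp : (fun x : Fin k → ℝ => ENNReal.ofReal (∏ i, gaussianPDFReal 0 1 (x i)))
      = fun x => (fun z : Fin k → ℝ =>
        ENNReal.ofReal (∏ i, gaussianPDFReal 0 1 (A⁻¹.mulVec z i))) (Matrix.toLin' A x) := by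
    ext x
    simp [Matrix.toLin'_apply, Matrix.mulVec_mulVec, Matrix.nonsing_inv_mul A hunit]
  rw [pi_gaussianReal_eq_withDensity, hcomp, map_withDensity_comp hm hg,
    Real.map_matrix_volume_pi_eq_smul_volume_pi hA, withDensity_smul_measure,
    ← withDensity_smul _ hg]
  congr 1
  ext z
  simp only [Pi.smul_apply, smul_eq_mul]
  rw [← ENNReal.ofReal_mul (abs_nonneg _), prod_gaussianPDFReal, mvNormalPDF, Matrix.det_mul,
    Matrix.det_transpose, Real.sqrt_mul (by positivity), Real.sqrt_mul_self_eq_abs, abs_inv]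
  have hq : A⁻¹.mulVec z ⬝ᵥ A⁻¹.mulVec z = z ⬝ᵥ ((A * A.transpose)⁻¹.mulVec z) := by
    rw [Matrix.mul_inv_rev, ← Matrix.transpose_nonsing_inv, Matrix.dotProduct_mulVec,
      Matrix.dotProduct_mulVec, ← Matrix.vecMul_vecMul, Matrix.vecMul_transpose]
  rw [hq]
  congr 1
  have : |A.det| ≠ 0 := abs_ne_zero.2 hA
  field_simp

/-- A centred Gaussian vector with positive definite covariance matrix has the usual density. -/
theorem hasLaw_mvNormalPDF {Ω : Type*} [MeasurableSpace Ω] {P : Measure Ω}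
    [IsProbabilityMeasure P] {k : ℕ} {X : Fin k → Ω → ℝ} {R : Matrix (Fin k) (Fin k) ℝ}
    (hX : HasGaussianLaw (fun ω i => X i ω) P) (hmean : ∀ i, ∫ ω, X i ω ∂P = 0)
    (hcov : ∀ i j, cov[X i, X j; P] = R i j) (hR : R.PosDef) :
    HasLaw (fun ω i => X i ω)
      (volume.withDensity fun z => ENNReal.ofReal (mvNormalPDF R z)) P := by
  obtain ⟨A, hA, hdet⟩ : ∃ A : Matrix (Fin k) (Fin k) ℝ, R = A * A.transpose ∧ A.det ≠ 0 := by
    open MatrixOrder in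
    obtain ⟨B, hB⟩ := CStarAlgebra.nonneg_iff_eq_star_mul_self.mp hR.posSemidef.nonneg
    refine ⟨B.transpose, by simpa [Matrix.star_eq_conjTranspose] using hB, fun h0 => ?_⟩
    have h1 := hR.isUnit
    rw [Matrix.isUnit_iff_isUnit_det, hB, Matrix.det_mul, ← Matrix.det_transpose B, h0,
      mul_zero] at h1
    exact not_isUnit_zero h1
  have hunit : IsUnit A.det := isUnit_iff_ne_zero.2 hdet
  -- Whitening: `A⁻¹ X` is Gaussian with identity covariance, hence a vector of independent standard
  -- normals, and `X` is its image under `A`.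
  let Y : Fin k → Ω → ℝ := fun i ω => ∑ j, A⁻¹ i j * X j ω
  have hXL : ∀ i, MemLp (X i) 2 P := fun i => (hX.eval i).memLp_two
  have hY : HasGaussianLaw (fun ω i => Y i ω) P := by
    let L : (Fin k → ℝ) →L[ℝ] (Fin k → ℝ) := LinearMap.toContinuousLinearMap (Matrix.toLin' A⁻¹)
    convert! hX.map_fun L using 1
  have hYmean : ∀ i, ∫ ω, Y i ω ∂P = 0 := by
    intro i
    simp only [Y]
    rw [integral_finsetSum _ fun j _ => ((hXL j).integrable (by norm_num)).const_mul _]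
    simp [integral_const_mul, hmean]
  have hYcov : ∀ i j, cov[Y i, Y j; P] = (1 : Matrix (Fin k) (Fin k) ℝ) i j := by
    intro i j
    have h1 : A⁻¹ * R * A⁻¹.transpose = 1 := by
      rw [hA, ← Matrix.mul_assoc, Matrix.nonsing_inv_mul A hunit, Matrix.one_mul,
        ← Matrix.transpose_mul, Matrix.nonsing_inv_mul A hunit, Matrix.transpose_one]
    rw [← h1]
    simp only [Y]
    rw [covariance_fun_sum_fun_sum (fun l => (hXL l).const_mul _) (fun l => (hXL l).const_mul _)]
    simp only [covariance_const_mul_left, covariance_const_mul_right, hcov, Matrix.mul_apply,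
      Matrix.transpose_apply, Finset.sum_mul]
    rw [Finset.sum_comm]
    refine Finset.sum_congr rfl fun a _ => Finset.sum_congr rfl fun b _ => ?_
    ring
  have hYlaw : P.map (fun ω i => Y i ω) = Measure.pi fun _ : Fin k => gaussianReal 0 1 := by
    have hind : iIndepFun Y P := hY.iIndepFun_of_covariance_eq_zero fun i j hij => by
      rw [hYcov, Matrix.one_apply_ne hij]
    rw [(iIndepFun_iff_map_fun_eq_pi_map fun i => (hY.eval i).aemeasurable).1 hind]
    congr 1
    ext1 i
    rw [(hY.eval i).map_eq_gaussianReal, hYmean, ← covariance_self (hY.eval i).aemeasurable,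
      hYcov, Matrix.one_apply_eq, Real.toNNReal_one]
  refine ⟨hX.aemeasurable, ?_⟩
  rw [hA, ← map_pi_gaussianReal_toLin' hdet, ← hYlaw, AEMeasurable.map_map_of_aemeasurable
    (LinearMap.continuous_of_finiteDimensional (Matrix.toLin' A)).measurable.aemeasurable
    hY.aemeasurable]
  congr 1
  ext ω i
  have : (fun i => Y i ω) = A⁻¹.mulVec fun i => X i ω := by
    ext i
    simp [Y, Matrix.mulVec, dotProduct]
  rw [Function.comp_apply, this, Matrix.toLin'_apply, Matrix.mulVec_mulVec,
    Matrix.mul_nonsing_inv A hunit, Matrix.one_mulVec]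

/-! ### Continuous distribution functions -/

section CDF

variable {ν : Measure ℝ}

theorem cdf_mem_Ioo (hmono : StrictMono (cdf ν)) (x : ℝ) : cdf ν x ∈ Ioo (0 : ℝ) 1 :=
  ⟨(cdf_nonneg ν (x - 1)).trans_lt (hmono (by linarith)),
    (hmono (by linarith : x < x + 1)).trans_le (cdf_le_one ν (x + 1))⟩

variable [IsProbabilityMeasure ν]

theorem continuous_cdf_of_absolutelyContinuous (hν : ν ≪ volume) : Continuous (cdf ν) := by
  refine continuous_iff_continuousAt.2 fun x => ?_
  rw [(cdf ν).mono.continuousAt_iff_leftLim_eq_rightLim, (cdf ν).rightLim_eq]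
  have h : (cdf ν).measure {x} = 0 := by
    rw [measure_cdf]
    exact hν (by simp)
  rw [StieltjesFunction.measure_singleton, ENNReal.ofReal_eq_zero] at h
  exact le_antisymm ((cdf ν).mono.leftLim_le le_rfl) (by linarith)

theorem exists_cdf_eq (hν : ν ≪ volume) {u : ℝ} (hu : u ∈ Ioo (0 : ℝ) 1) :
    ∃ x, cdf ν x = u := by
  obtain ⟨a, ha⟩ := ((tendsto_cdf_atBot ν).eventually_lt_const hu.1).exists
  obtain ⟨b, hb⟩ := ((tendsto_cdf_atTop ν).eventually_const_lt hu.2).exists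
  exact mem_range_of_exists_le_of_exists_ge (continuous_cdf_of_absolutelyContinuous hν)
    ⟨a, ha.le⟩ ⟨b, hb.le⟩

theorem quantile_apply {F : ℝ → ℝ} (hF : StrictMono F) (x : ℝ) : quantile F (F x) = x := by
  have : {y | F x ≤ F y} = Ici x := by
    ext y
    simp [hF.le_iff_le]
  rw [quantile, this, csInf_Ici]

/-- The probability integral transform. -/
theorem map_cdf_eq_uniform (hν : ν ≪ volume) (hmono : StrictMono (cdf ν)) :
    ν.map (cdf ν) = volume.restrict (Icc (0 : ℝ) 1) := by
  have : IsProbabilityMeasure (volume.restrict (Icc (0 : ℝ) 1)) := ⟨by simp⟩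
  have hm : Measurable (cdf ν) := (continuous_cdf_of_absolutelyContinuous hν).measurable
  have := Measure.isProbabilityMeasure_map (μ := ν) hm.aemeasurable
  refine Measure.ext_of_Iic _ _ fun a => ?_
  rw [Measure.map_apply hm measurableSet_Iic, Measure.restrict_apply measurableSet_Iic]
  rcases le_or_gt a 0 with h0 | h0
  · have h1 : cdf ν ⁻¹' Iic a = ∅ := by
      ext x
      simpa using h0.trans_lt (cdf_mem_Ioo hmono x).1
    have h2 : Iic a ∩ Icc (0 : ℝ) 1 ⊆ {0} := fun x hx =>
      le_antisymm (le_trans hx.1 h0) hx.2.1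
    rw [h1, measure_empty, measure_mono_null h2 (by simp)]
  · rcases le_or_gt 1 a with h1 | h1
    · have h2 : cdf ν ⁻¹' Iic a = univ := by
        ext x
        simpa using (cdf_le_one ν x).trans h1
      have h3 : Iic a ∩ Icc (0 : ℝ) 1 = Icc 0 1 := by
        ext x
        simp only [mem_inter_iff, mem_Iic, mem_Icc]
        constructor
        · exact fun h => h.2
        · exact fun h => ⟨h.2.trans h1, h⟩
      rw [h2, h3]
      simp
    · obtain ⟨x, rfl⟩ := exists_cdf_eq hν ⟨h0, h1⟩
      have h2 : cdf ν ⁻¹' Iic (cdf ν x) = Iic x := by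
        ext y
        simp [hmono.le_iff_le]
      have h3 : Iic (cdf ν x) ∩ Icc (0 : ℝ) 1 = Icc 0 (cdf ν x) := by
        ext y
        simp only [mem_inter_iff, mem_Iic, mem_Icc]
        constructor
        · exact fun h => ⟨h.2.1, h.1⟩
        · exact fun h => ⟨h.2, h.1, h.2.trans h1.le⟩
      rw [h2, h3, Real.volume_Icc, sub_zero, ofReal_cdf]

theorem strictMono_cdf_of_absolutelyContinuous (hν : volume ≪ ν) : StrictMono (cdf ν) := by
  intro x y hxy
  have h : ν (Ioc x y) ≠ 0 := fun h => by
    have := hν h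
    simp only [Real.volume_Ioc, ENNReal.ofReal_eq_zero] at this
    linarith
  rw [← measure_cdf ν, StieltjesFunction.measure_Ioc] at h
  have : ¬ (cdf ν y - cdf ν x ≤ 0) := fun h' => h (ENNReal.ofReal_eq_zero.2 h')
  linarith

end CDF

theorem strictMono_stdNormalCDF : StrictMono stdNormalCDF :=
  strictMono_cdf_of_absolutelyContinuous (gaussianReal_absolutelyContinuous' 0 one_ne_zero)

theorem measurable_stdNormalCDF : Measurable stdNormalCDF :=
  strictMono_stdNormalCDF.monotone.measurable

theorem map_stdNormalCDF :
    (gaussianReal 0 1).map stdNormalCDF = volume.restrict (Icc (0 : ℝ) 1) :=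
  map_cdf_eq_uniform (gaussianReal_absolutelyContinuous 0 one_ne_zero) strictMono_stdNormalCDF

/-! ### The shape of a v-transform -/

theorem VolatilityProxy.profile_spec (T : VolatilityProxy) {x : ℝ} (hx : 0 ≤ x) :
    0 ≤ T.profile x ∧ T.T₂ (T.profile x) = T.T₁ x := by
  have h : ∃ y ∈ Ici (0 : ℝ), T.T₂ y = T.T₁ x := by
    have : T.T₁ x ∈ T.T₂ '' Ici 0 := T.range_eq ▸ mem_image_of_mem _ hx
    exact this
  exact ⟨Function.invFunOn_mem h, Function.invFunOn_eq h⟩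

theorem VolatilityProxy.profileInv_spec (T : VolatilityProxy) {x : ℝ} (hx : 0 ≤ x) :
    0 ≤ T.profileInv x ∧ T.T₁ (T.profileInv x) = T.T₂ x := by
  have h : ∃ y ∈ Ici (0 : ℝ), T.T₁ y = T.T₂ x := by
    have : T.T₂ x ∈ T.T₁ '' Ici 0 := T.range_eq ▸ mem_image_of_mem _ hx
    exact this
  exact ⟨Function.invFunOn_mem h, Function.invFunOn_eq h⟩

theorem VolatilityProxy.profile_zero (T : VolatilityProxy) : T.profile 0 = 0 := by
  obtain ⟨h1, h2⟩ := T.profile_spec le_rfl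
  exact T.strictMono_T₂.injOn h1 self_mem_Ici (h2.trans T.map_zero)

theorem VolatilityProxy.profile_profileInv (T : VolatilityProxy) {x : ℝ} (hx : 0 ≤ x) :
    T.profile (T.profileInv x) = x := by
  obtain ⟨h1, h2⟩ := T.profileInv_spec hx
  obtain ⟨h3, h4⟩ := T.profile_spec h1
  exact T.strictMono_T₂.injOn h3 hx (h4.trans h2)

theorem VolatilityProxy.profile_strictMonoOn (T : VolatilityProxy) :
    StrictMonoOn T.profile (Ici 0) := by
  intro x hx y hy hxy
  obtain ⟨h1, h2⟩ := T.profile_spec hx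
  obtain ⟨h3, h4⟩ := T.profile_spec hy
  refine (T.strictMono_T₂.lt_iff_lt h1 h3).1 ?_
  rw [h2, h4]
  exact T.strictMono_T₁ hx hy hxy

/-- The properties of a v-transform on which stochastic inversion depends: `u ↦ u + V u` is a
decreasing bijection of `[0, δ]` onto `[δ, 1]` that preserves the value of `V`. -/
structure HasVShape (V : ℝ → ℝ) (δ : ℝ) : Prop where
  pos : 0 < δ
  lt_one : δ < 1
  apply_zero : V 0 = 1
  apply_fulcrum : V δ = 0
  strictAntiOn_add : StrictAntiOn (fun u => u + V u) (Icc 0 δ)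
  exists_dual : ∀ u ∈ Icc δ 1, ∃ u' ∈ Icc (0 : ℝ) δ, u' + V u' = u ∧ V u = V u'

/-- For `u = F x` with `x ≤ μ`, the definition gives `u + V u = F (μ + g (μ - x))`, which decreases
in `x` since `g` increases. The dual of `F x` with `x > μ` is `F (μ - g⁻¹ (x - μ))`. The endpoints
`0`, `1`, where no `x` exists, rest on the prescribed values of `V`. -/
theorem IsVTransform.hasVShape {V : ℝ → ℝ} {δ : ℝ} (h : IsVTransform V δ) : HasVShape V δ := by
  obtain ⟨ν, T, hprob, hν, hmono, rfl, h0, h1, hV⟩ := h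
  have hleft : ∀ x ≤ T.μ, V (cdf ν x) = cdf ν (T.μ + T.profile (T.μ - x)) - cdf ν x := by
    intro x hx
    rw [hV _ (cdf_mem_Ioo hmono x), vFormula, if_pos (hmono.monotone hx), quantile_apply hmono]
  have hδ : V (cdf ν T.μ) = 0 := by
    rw [hleft _ le_rfl, sub_self, T.profile_zero, add_zero, sub_self]
  refine ⟨(cdf_mem_Ioo hmono _).1, (cdf_mem_Ioo hmono _).2, h0, hδ, ?_, ?_⟩
  · intro u₁ hu₁ u₂ hu₂ hlt
    have hu₂' : u₂ ∈ Ioo (0 : ℝ) 1 :=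
      ⟨hu₁.1.trans_lt hlt, hu₂.2.trans_lt (cdf_mem_Ioo hmono _).2⟩
    obtain ⟨x₂, rfl⟩ := exists_cdf_eq hν hu₂'
    have hx₂ : x₂ ≤ T.μ := hmono.le_iff_le.1 hu₂.2
    simp only [hleft x₂ hx₂, add_sub_cancel]
    rcases hu₁.1.eq_or_lt with rfl | hpos
    · rw [h0, zero_add]
      exact (cdf_mem_Ioo hmono _).2
    · obtain ⟨x₁, rfl⟩ := exists_cdf_eq hν ⟨hpos, hlt.trans hu₂'.2⟩
      have hx₁ : x₁ ≤ T.μ := hmono.le_iff_le.1 hu₁.2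
      have hx : x₁ < x₂ := hmono.lt_iff_lt.1 hlt
      rw [hleft x₁ hx₁, add_sub_cancel]
      refine hmono (add_lt_add_right (T.profile_strictMonoOn ?_ ?_ ?_) _)
      · exact sub_nonneg.2 hx₂
      · exact sub_nonneg.2 hx₁
      · linarith
  · intro u hu
    rcases hu.2.eq_or_lt with rfl | hu1
    · exact ⟨0, ⟨le_rfl, (cdf_mem_Ioo hmono _).1.le⟩, by rw [h0, zero_add], by rw [h1, h0]⟩
    rcases hu.1.eq_or_lt with rfl | hδu
    · exact ⟨_, ⟨(cdf_mem_Ioo hmono _).1.le, le_rfl⟩, by rw [hδ, add_zero], rfl⟩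
    have hu' : u ∈ Ioo (0 : ℝ) 1 := ⟨(cdf_mem_Ioo hmono _).1.trans hδu, hu1⟩
    obtain ⟨x, rfl⟩ := exists_cdf_eq hν hu'
    have hx : T.μ < x := hmono.lt_iff_lt.1 hδu
    obtain ⟨hy, -⟩ := T.profileInv_spec (sub_nonneg.2 hx.le)
    have hV' : V (cdf ν (T.μ - T.profileInv (x - T.μ)))
        = cdf ν x - cdf ν (T.μ - T.profileInv (x - T.μ)) := by
      rw [hleft _ (by linarith), sub_sub_cancel, T.profile_profileInv (sub_nonneg.2 hx.le),
        add_sub_cancel]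
    refine ⟨cdf ν (T.μ - T.profileInv (x - T.μ)), ⟨cdf_nonneg _ _, hmono.monotone (by linarith)⟩,
      by rw [hV', add_sub_cancel], ?_⟩
    rw [hV', hV _ hu', vFormula, if_neg (not_le.2 hδu), quantile_apply hmono]

namespace HasVShape

variable {V : ℝ → ℝ} {δ : ℝ} (h : HasVShape V δ)
include h

theorem strictAntiOn : StrictAntiOn V (Icc 0 δ) := by
  intro a ha b hb hab
  have := h.strictAntiOn_add ha hb hab
  simp only at this
  linarith

theorem left_mem : (0 : ℝ) ∈ Icc 0 δ := ⟨le_rfl, h.pos.le⟩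

theorem right_mem : δ ∈ Icc 0 δ := ⟨h.pos.le, le_rfl⟩

theorem add_mem {u : ℝ} (hu : u ∈ Icc 0 δ) : u + V u ∈ Icc δ 1 := by
  have h1 := h.strictAntiOn_add.antitoneOn h.left_mem hu hu.1
  have h2 := h.strictAntiOn_add.antitoneOn hu h.right_mem hu.2
  simp only [h.apply_zero, h.apply_fulcrum] at h1 h2
  exact ⟨by linarith, by linarith⟩

/-- A monotone surjection between intervals is continuous. It is applied to `u ↦ u + V u`, made
monotone by reversing the order of the target. -/
theorem continuousOn : ContinuousOn V (Icc 0 δ) := by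
  let f : Icc (0 : ℝ) δ → (Icc δ 1)ᵒᵈ := fun u => OrderDual.toDual ⟨u + V u, h.add_mem u.2⟩
  have hf : Monotone f := fun a b hab => h.strictAntiOn_add.antitoneOn a.2 b.2 hab
  have hs : Function.Surjective f := by
    intro y
    obtain ⟨u, hu, hy, -⟩ := h.exists_dual (OrderDual.ofDual y).1 (OrderDual.ofDual y).2
    exact ⟨⟨u, hu⟩, congrArg OrderDual.toDual (Subtype.ext hy)⟩
  have hc : Continuous f := hf.continuous_of_surjective hs
  have hc' : Continuous fun u => (OrderDual.ofDual (f u)).1 :=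
    continuous_subtype_val.comp (continuous_ofDual.comp hc)
  rw [continuousOn_iff_continuous_domRestrict]
  convert! hc'.sub continuous_subtype_val using 1
  ext u
  simp [f]

theorem exists_left {v : ℝ} (hv : v ∈ Icc (0 : ℝ) 1) : ∃ u ∈ Icc 0 δ, V u = v := by
  have := intermediate_value_Icc' h.pos.le h.continuousOn
  rw [h.apply_zero, h.apply_fulcrum] at this
  exact this hv

theorem vInv_apply {u : ℝ} (hu : u ∈ Icc 0 δ) : vInv V (V u) = u := by
  refine IsLeast.csInf_eq ⟨⟨⟨hu.1, hu.2.trans h.lt_one.le⟩, rfl⟩, ?_⟩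
  rintro x ⟨hx, hVx⟩
  rcases le_or_gt x δ with hxδ | hxδ
  · exact (h.strictAntiOn.injOn ⟨hx.1, hxδ⟩ hu hVx).ge
  · exact hu.2.trans hxδ.le

theorem vInv_mem {v : ℝ} (hv : v ∈ Icc (0 : ℝ) 1) : vInv V v ∈ Icc 0 δ := by
  obtain ⟨u, hu, rfl⟩ := h.exists_left hv
  rwa [h.vInv_apply hu]

theorem apply_vInv {v : ℝ} (hv : v ∈ Icc (0 : ℝ) 1) : V (vInv V v) = v := by
  obtain ⟨u, hu, rfl⟩ := h.exists_left hv
  rw [h.vInv_apply hu]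

theorem apply_add {u : ℝ} (hu : u ∈ Icc 0 δ) : V (u + V u) = V u := by
  obtain ⟨u', hu', h1, h2⟩ := h.exists_dual _ (h.add_mem hu)
  rw [h2, h.strictAntiOn_add.injOn hu' hu h1]

theorem apply_add_vInv {v : ℝ} (hv : v ∈ Icc (0 : ℝ) 1) : V (v + vInv V v) = v := by
  obtain ⟨u, hu, rfl⟩ := h.exists_left hv
  rw [h.vInv_apply hu, add_comm, h.apply_add hu]

theorem add_vInv_mem {v : ℝ} (hv : v ∈ Icc (0 : ℝ) 1) : v + vInv V v ∈ Icc δ 1 := by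
  have := h.add_mem (h.vInv_mem hv)
  rwa [h.apply_vInv hv, add_comm] at this

theorem apply_mem {u : ℝ} (hu : u ∈ Icc (0 : ℝ) 1) : V u ∈ Icc (0 : ℝ) 1 := by
  have key : ∀ u ∈ Icc 0 δ, V u ∈ Icc (0 : ℝ) 1 := by
    intro u hu
    have h1 := h.strictAntiOn.antitoneOn h.left_mem hu hu.1
    have h2 := h.strictAntiOn.antitoneOn hu h.right_mem hu.2
    rw [h.apply_zero] at h1
    rw [h.apply_fulcrum] at h2
    exact ⟨h2, h1⟩
  rcases le_total u δ with h1 | h1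
  · exact key u ⟨hu.1, h1⟩
  · obtain ⟨u', hu', -, h2⟩ := h.exists_dual u ⟨h1, hu.2⟩
    rw [h2]
    exact key u' hu'

theorem vInv_zero : vInv V 0 = δ := by
  rw [← h.apply_fulcrum, h.vInv_apply h.right_mem]

theorem vInv_one : vInv V 1 = 0 := by
  rw [← h.apply_zero, h.vInv_apply h.left_mem]

theorem vInv_strictAntiOn : StrictAntiOn (vInv V) (Icc 0 1) := by
  intro a ha b hb hab
  rw [← h.apply_vInv ha, ← h.apply_vInv hb] at hab
  exact (h.strictAntiOn.lt_iff_gt (h.vInv_mem ha) (h.vInv_mem hb)).1 hab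

/-- The map is the composite of two decreasing ones, `vInv V` and `u ↦ u + V u`. -/
theorem add_vInv_strictMonoOn : StrictMonoOn (fun v => v + vInv V v) (Icc 0 1) := by
  intro a ha b hb hab
  have := h.strictAntiOn_add (h.vInv_mem hb) (h.vInv_mem ha) (h.vInv_strictAntiOn ha hb hab)
  simp only [h.apply_vInv ha, h.apply_vInv hb] at this
  simp only
  linarith

theorem antitoneOn_left : AntitoneOn V (Icc 0 δ) := h.strictAntiOn.antitoneOn

theorem monotoneOn_right : MonotoneOn V (Icc δ 1) := by
  intro a ha b hb hab
  obtain ⟨a', ha', h1, h2⟩ := h.exists_dual a ha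
  obtain ⟨b', hb', h3, h4⟩ := h.exists_dual b hb
  rw [h2, h4]
  refine h.antitoneOn_left hb' ha' ((h.strictAntiOn_add.le_iff_ge ha' hb').1 ?_)
  simp only [h1, h3, hab]

/-- A v-transform agrees on `[0, 1]` with a measurable function. -/
theorem exists_measurable : ∃ V' : ℝ → ℝ, Measurable V' ∧ EqOn V' V (Icc 0 1) := by
  -- `V` is arbitrary off `[0, 1]`, so each branch is evaluated at a clamped argument, which makes
  -- it monotone on all of `ℝ`.
  have hl : Antitone fun u => V (max 0 (min δ u)) := by
    intro a b hab
    refine h.antitoneOn_left ?_ ?_ (max_le_max le_rfl (min_le_min le_rfl hab))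
    · exact ⟨le_max_left _ _, max_le h.pos.le (min_le_left _ _)⟩
    · exact ⟨le_max_left _ _, max_le h.pos.le (min_le_left _ _)⟩
  have hr : Monotone fun u => V (max δ (min 1 u)) := by
    intro a b hab
    refine h.monotoneOn_right ?_ ?_ (max_le_max le_rfl (min_le_min le_rfl hab))
    · exact ⟨le_max_left _ _, max_le h.lt_one.le (min_le_left _ _)⟩
    · exact ⟨le_max_left _ _, max_le h.lt_one.le (min_le_left _ _)⟩
  refine ⟨fun u => if u ≤ δ then V (max 0 (min δ u)) else V (max δ (min 1 u)),
    Measurable.ite measurableSet_Iic hl.measurable hr.measurable, fun u hu => ?_⟩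
  simp only
  split_ifs with hδ
  · rw [min_eq_right hδ, max_eq_right hu.1]
  · rw [min_eq_right hu.2, max_eq_right (not_le.1 hδ).le]

end HasVShape

/-! ### Differentiability of the inverse of the left branch -/

/-- The inverse of the left branch, extended to `ℝ` by constants. -/
def vInvExt (V : ℝ → ℝ) (v : ℝ) : ℝ := vInv V (max 0 (min 1 v))

theorem vInvExt_eq {V : ℝ → ℝ} {v : ℝ} (hv : v ∈ Icc (0 : ℝ) 1) : vInvExt V v = vInv V v := by
  rw [vInvExt, min_eq_right hv.2, max_eq_right hv.1]

theorem clamp_mem (v : ℝ) : max 0 (min 1 v) ∈ Icc (0 : ℝ) 1 :=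
  ⟨le_max_left _ _, max_le zero_le_one (min_le_left _ _)⟩

namespace HasVShape

variable {V : ℝ → ℝ} {δ : ℝ} (h : HasVShape V δ)
include h

theorem antitone_vInvExt : Antitone (vInvExt V) := fun a b hab =>
  h.vInv_strictAntiOn.antitoneOn (clamp_mem a) (clamp_mem b)
    (max_le_max le_rfl (min_le_min le_rfl hab))

/-- `vInv V` decreases, but adding `v` makes it increase, so it cannot fall faster than slope `-1`.
-/
theorem lipschitz_vInvExt : LipschitzWith 1 (vInvExt V) := by
  have key : ∀ a b, a ≤ b → |vInvExt V a - vInvExt V b| ≤ |a - b| := by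
    intro a b hab
    have h1 := h.antitone_vInvExt hab
    have h2 := h.add_vInv_strictMonoOn.monotoneOn (clamp_mem a) (clamp_mem b)
      (max_le_max le_rfl (min_le_min le_rfl hab))
    have h3 : max 0 (min 1 b) - max 0 (min 1 a) ≤ b - a := by
      rcases max_cases 0 (min 1 b) with ⟨_, _⟩ | ⟨_, _⟩ <;>
      rcases max_cases 0 (min 1 a) with ⟨_, _⟩ | ⟨_, _⟩ <;>
      rcases min_cases 1 b with ⟨_, _⟩ | ⟨_, _⟩ <;>
      rcases min_cases 1 a with ⟨_, _⟩ | ⟨_, _⟩ <;> linarith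
    rw [abs_of_nonneg (sub_nonneg.2 h1), abs_of_nonpos (sub_nonpos.2 hab)]
    unfold vInvExt
    linarith
  refine LipschitzWith.of_dist_le_mul fun a b => ?_
  rw [NNReal.coe_one, one_mul, Real.dist_eq, Real.dist_eq]
  rcases le_total a b with hab | hab
  · exact key a b hab
  · rw [abs_sub_comm, abs_sub_comm a]
    exact key b a hab

theorem neg_deriv_vInvExt_nonneg (v : ℝ) : 0 ≤ -deriv (vInvExt V) v :=
  neg_nonneg.2 h.antitone_vInvExt.deriv_nonpos

theorem neg_deriv_vInvExt_le_one (v : ℝ) : -deriv (vInvExt V) v ≤ 1 := by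
  have := norm_deriv_le_of_lipschitz (x₀ := v) h.lipschitz_vInvExt
  rw [Real.norm_eq_abs, NNReal.coe_one] at this
  exact (neg_le_abs _).trans this

/-- The conditional down probability is almost everywhere minus the derivative of the inverse of
the left branch. -/
theorem downProb_eq {v : ℝ} (hv : v ∈ Ioo (0 : ℝ) 1)
    (hd : DifferentiableAt ℝ (vInvExt V) v) :
    downProb V δ v = -deriv (vInvExt V) v := by
  have hv' : v ∈ Icc (0 : ℝ) 1 := Ioo_subset_Icc_self hv
  set u := vInv V v with hu
  have hum := h.vInv_mem hv'
  have hVu : V u = v := h.apply_vInv hv'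
  have hu0 : 0 < u := by
    have := h.vInv_strictAntiOn hv' ⟨zero_le_one, le_rfl⟩ hv.2
    rwa [h.vInv_one] at this
  have huδ : u < δ := by
    have := h.vInv_strictAntiOn ⟨le_rfl, zero_le_one⟩ hv' hv.1
    rwa [h.vInv_zero] at this
  have hmem : Icc (0 : ℝ) 1 ∈ nhds u := Icc_mem_nhds hu0 (huδ.trans h.lt_one)
  have hmem' : Icc (0 : ℝ) δ ∈ nhds u := Icc_mem_nhds hu0 huδ
  have hinv : ∀ᶠ x in nhds u, vInvExt V (V x) = x := by
    filter_upwards [hmem'] with x hx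
    rw [vInvExt_eq (h.apply_mem ⟨hx.1, hx.2.trans h.lt_one.le⟩), h.vInv_apply hx]
  have hda : HasDerivAt (vInvExt V) (deriv (vInvExt V) v) (V u) := by
    rw [hVu]
    exact hd.hasDerivAt
  rw [downProb, ← hu, vGradient, if_neg huδ.ne, derivWithin_of_mem_nhds hmem]
  -- If the inverse has slope `0`, the chain rule forbids `V` to be differentiable at `u`; `deriv`
  -- then defaults to `0`, and `-1 / 0 = 0` is the correct value. Otherwise the inverse function
  -- rule applies.
  rcases eq_or_ne (deriv (vInvExt V) v) 0 with h0 | h0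
  · rw [h0]
    by_cases hV : DifferentiableAt ℝ V u
    · exfalso
      have h1 := hda.comp u hV.hasDerivAt
      have h2 := h1.congr_of_eventuallyEq (f₁ := fun x => x)
        (by filter_upwards [hinv] with x hx; exact hx.symm)
      have h3 := h2.unique (hasDerivAt_id u)
      rw [h0, zero_mul] at h3
      exact zero_ne_one h3
    · rw [deriv_zero_of_not_differentiableAt hV]
      simp
  · have hVd : HasDerivAt V (deriv (vInvExt V) v)⁻¹ u :=
      HasDerivAt.of_local_left_inverse ((h.continuousOn u hum).continuousAt hmem') hda h0 hinv
    rw [hVd.deriv, div_inv_eq_mul, neg_one_mul]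

/-- A Lipschitz function is absolutely continuous, so its almost everywhere derivative recovers it;
the boundary term vanishes as `vInv V 1 = 0`. -/
theorem integral_neg_deriv_vInvExt {a : ℝ} (ha : a ∈ Icc (0 : ℝ) 1) :
    ∫ v in a..1, -deriv (vInvExt V) v = vInv V a := by
  rw [intervalIntegral.integral_neg,
    (h.lipschitz_vInvExt.lipschitzOnWith).absolutelyContinuousOnInterval.integral_deriv_eq_sub,
    vInvExt_eq ha, vInvExt_eq ⟨zero_le_one, le_rfl⟩, h.vInv_one, zero_sub, neg_neg]

theorem lintegral_neg_deriv_vInvExt {a : ℝ} (ha : a ∈ Icc (0 : ℝ) 1) :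
    ∫⁻ v in Ioc a 1, ENNReal.ofReal (-deriv (vInvExt V) v) = ENNReal.ofReal (vInv V a) := by
  have hi : IntervalIntegrable (fun v => -deriv (vInvExt V) v) volume a 1 :=
    (h.lipschitz_vInvExt.lipschitzOnWith).absolutelyContinuousOnInterval.intervalIntegrable_deriv.neg
  rw [← h.integral_neg_deriv_vInvExt ha, intervalIntegral.integral_of_le ha.2,
    ofReal_integral_eq_lintegral_ofReal ((intervalIntegrable_iff_integrableOn_Ioc_of_le ha.2).1 hi)
      (Filter.Eventually.of_forall h.neg_deriv_vInvExt_nonneg)]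

end HasVShape

/-! ### Stochastic inversion of a v-transform -/

/-- The stochastic inversion function with the conditional down probability replaced by the
derivative of the inverse of the left branch. -/
def stochInvDeriv (V : ℝ → ℝ) (v w : ℝ) : ℝ :=
  if w ≤ -deriv (vInvExt V) v then vInvExt V v else v + vInvExt V v

namespace HasVShape

variable {V : ℝ → ℝ} {δ : ℝ} (h : HasVShape V δ)
include h

theorem measurable_stochInvDeriv : Measurable fun x : ℝ × ℝ => stochInvDeriv V x.1 x.2 := by
  have h1 := h.lipschitz_vInvExt.continuous.measurable
  have h2 := measurable_deriv (vInvExt V)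
  exact Measurable.ite (measurableSet_le measurable_snd (by fun_prop)) (by fun_prop) (by fun_prop)

theorem stochInvDeriv_mem {v : ℝ} (hv : v ∈ Icc (0 : ℝ) 1) (w : ℝ) :
    stochInvDeriv V v w ∈ Icc (0 : ℝ) 1 := by
  unfold stochInvDeriv
  rw [vInvExt_eq hv]
  split_ifs
  · exact Icc_subset_Icc_right h.lt_one.le (h.vInv_mem hv)
  · exact Icc_subset_Icc_left h.pos.le (h.add_vInv_mem hv)

theorem apply_stochInvDeriv {v : ℝ} (hv : v ∈ Icc (0 : ℝ) 1) (w : ℝ) :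
    V (stochInvDeriv V v w) = v := by
  unfold stochInvDeriv
  rw [vInvExt_eq hv]
  split_ifs
  · exact h.apply_vInv hv
  · exact h.apply_add_vInv hv

theorem stochInv_eq {v : ℝ} (hv : v ∈ Ioo (0 : ℝ) 1)
    (hd : DifferentiableAt ℝ (vInvExt V) v) (w : ℝ) :
    stochInv V δ v w = stochInvDeriv V v w := by
  rw [stochInv, stochInvDeriv, h.downProb_eq hv hd, vInvExt_eq (Ioo_subset_Icc_self hv)]

theorem volume_le_neg_deriv (v : ℝ) :
    volume.restrict (Icc (0 : ℝ) 1) {w | w ≤ -deriv (vInvExt V) v}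
      = ENNReal.ofReal (-deriv (vInvExt V) v) := by
  have h1 : {w | w ≤ -deriv (vInvExt V) v} ∩ Icc 0 1 = Icc 0 (-deriv (vInvExt V) v) := by
    ext w
    simp only [mem_inter_iff, mem_ofPred_eq, mem_Icc]
    constructor
    · exact fun hw => ⟨hw.2.1, hw.1⟩
    · exact fun hw => ⟨hw.2, hw.1, hw.2.trans (h.neg_deriv_vInvExt_le_one v)⟩
  rw [Measure.restrict_apply' measurableSet_Icc, h1, Real.volume_Icc, sub_zero]

/-- Below the fulcrum only the left branch contributes, and only for `v ≥ V a`, each `v` with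
probability `Δ(v)`. The integral of `Δ` over `[V a, 1]` is `vInv V (V a) = a`. -/
theorem lintegral_slice_of_lt {a : ℝ} (ha0 : 0 ≤ a) (ha : a < δ) :
    ∫⁻ v in Icc (0 : ℝ) 1, volume.restrict (Icc (0 : ℝ) 1) {w | stochInvDeriv V v w ≤ a}
      = ENNReal.ofReal a := by
  have ham : a ∈ Icc 0 δ := ⟨ha0, ha.le⟩
  have hVa := h.apply_mem ⟨ha0, ha.le.trans h.lt_one.le⟩
  have hslice : ∀ v ∈ Icc (0 : ℝ) 1,
      volume.restrict (Icc (0 : ℝ) 1) {w | stochInvDeriv V v w ≤ a}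
        = (Ici (V a)).indicator (fun v => ENNReal.ofReal (-deriv (vInvExt V) v)) v := by
    intro v hv
    have hiff : vInv V v ≤ a ↔ V a ≤ v := by
      conv_lhs => rw [← h.vInv_apply ham]
      exact h.vInv_strictAntiOn.le_iff_ge hv hVa
    have hadd := (h.add_vInv_mem hv).1
    by_cases hva : V a ≤ v
    · rw [indicator_of_mem (by exact hva), ← h.volume_le_neg_deriv v]
      congr 1
      ext w
      simp only [mem_ofPred_eq, stochInvDeriv, vInvExt_eq hv]
      split_ifs with hw
      · simp [hw, hiff.2 hva]
      · simp only [hw, iff_false, not_le]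
        linarith
    · rw [indicator_of_notMem (by exact hva)]
      have hempty : {w | stochInvDeriv V v w ≤ a} = ∅ := by
        ext w
        simp only [mem_ofPred_eq, stochInvDeriv, vInvExt_eq hv, mem_empty_iff_false, iff_false,
          not_le]
        split_ifs with hw
        · exact not_le.1 fun hc => hva (hiff.1 hc)
        · linarith
      rw [hempty, measure_empty]
  have hset : Ici (V a) ∩ Icc 0 1 = Icc (V a) 1 := by
    ext v
    simp only [mem_inter_iff, mem_Ici, mem_Icc]
    exact ⟨fun hv => ⟨hv.1, hv.2.2⟩, fun hv => ⟨hv.1, hVa.1.trans hv.1, hv.2⟩⟩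
  rw [setLIntegral_congr_fun measurableSet_Icc hslice, lintegral_indicator measurableSet_Ici,
    Measure.restrict_restrict measurableSet_Ici, hset, ← setLIntegral_congr Ioc_ae_eq_Icc,
    h.lintegral_neg_deriv_vInvExt hVa, h.vInv_apply ham]

/-- Left values never exceed `a`, and right values stay below it exactly when `v ≤ V a`. The slice
thus has mass `1` up to `V a` and `Δ(v)` beyond, in total `V a + vInv V (V a) = a`. -/
theorem lintegral_slice_of_ge {a : ℝ} (ha : δ ≤ a) (ha1 : a ≤ 1) :
    ∫⁻ v in Icc (0 : ℝ) 1, volume.restrict (Icc (0 : ℝ) 1) {w | stochInvDeriv V v w ≤ a}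
      = ENNReal.ofReal a := by
  have hVa := h.apply_mem ⟨h.pos.le.trans ha, ha1⟩
  have hsum : V a + vInv V (V a) = a := by
    obtain ⟨u, hu, h1, h2⟩ := h.exists_dual a ⟨ha, ha1⟩
    rw [h2, h.vInv_apply hu, add_comm, h1]
  have hslice : ∀ v ∈ Icc (0 : ℝ) 1,
      volume.restrict (Icc (0 : ℝ) 1) {w | stochInvDeriv V v w ≤ a}
        = (Iic (V a)).indicator (fun _ => 1) v
          + (Ioi (V a)).indicator (fun v => ENNReal.ofReal (-deriv (vInvExt V) v)) v := by
    intro v hv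
    have hiff : v + vInv V v ≤ a ↔ v ≤ V a := by
      conv_lhs => rw [← hsum]
      exact h.add_vInv_strictMonoOn.le_iff_le hv hVa
    have hle := (h.vInv_mem hv).2
    by_cases hva : v ≤ V a
    · rw [indicator_of_mem (by exact hva), indicator_of_notMem (by simpa using hva), add_zero]
      have huniv : {w | stochInvDeriv V v w ≤ a} = univ := by
        ext w
        simp only [mem_ofPred_eq, stochInvDeriv, vInvExt_eq hv, mem_univ, iff_true]
        split_ifs with hw
        · linarith
        · exact hiff.2 hva
      rw [huniv]
      simp
    · rw [indicator_of_notMem (by exact hva), indicator_of_mem (by simpa using hva), zero_add,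
        ← h.volume_le_neg_deriv v]
      congr 1
      ext w
      simp only [mem_ofPred_eq, stochInvDeriv, vInvExt_eq hv]
      split_ifs with hw
      · simp only [hw, iff_true]
        linarith
      · simp only [hw, iff_false]
        exact fun hc => hva (hiff.1 hc)
  have hset1 : Iic (V a) ∩ Icc 0 1 = Icc 0 (V a) := by
    ext v
    simp only [mem_inter_iff, mem_Iic, mem_Icc]
    exact ⟨fun hv => ⟨hv.2.1, hv.1⟩, fun hv => ⟨hv.2, hv.1, hv.2.trans hVa.2⟩⟩
  have hset2 : Ioi (V a) ∩ Icc 0 1 = Ioc (V a) 1 := by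
    ext v
    simp only [mem_inter_iff, mem_Ioi, mem_Icc, mem_Ioc]
    exact ⟨fun hv => ⟨hv.1, hv.2.2⟩, fun hv => ⟨hv.1, hVa.1.trans hv.1.le, hv.2⟩⟩
  rw [setLIntegral_congr_fun measurableSet_Icc hslice,
    lintegral_add_left (measurable_const.indicator measurableSet_Iic),
    lintegral_indicator measurableSet_Iic, lintegral_indicator measurableSet_Ioi,
    Measure.restrict_restrict measurableSet_Iic, Measure.restrict_restrict measurableSet_Ioi,
    hset1, hset2, h.lintegral_neg_deriv_vInvExt hVa, setLIntegral_one, Real.volume_Icc, sub_zero,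
    ← ENNReal.ofReal_add hVa.1 (h.vInv_mem hVa).1, hsum]

/-- Stochastic inversion maps a pair of independent uniform variables to a uniform variable. -/
theorem map_stochInvDeriv :
    ((volume.restrict (Icc (0 : ℝ) 1)).prod (volume.restrict (Icc (0 : ℝ) 1))).map
      (fun x : ℝ × ℝ => stochInvDeriv V x.1 x.2) = volume.restrict (Icc (0 : ℝ) 1) := by
  have hp : IsProbabilityMeasure (volume.restrict (Icc (0 : ℝ) 1)) := ⟨by simp⟩
  have hm := h.measurable_stochInvDeriv
  have := Measure.isProbabilityMeasure_map
    (μ := (volume.restrict (Icc (0 : ℝ) 1)).prod (volume.restrict (Icc (0 : ℝ) 1)))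
    hm.aemeasurable
  refine Measure.ext_of_Iic _ _ fun a => ?_
  rw [Measure.map_apply hm measurableSet_Iic, Measure.prod_apply (hm measurableSet_Iic),
    Measure.restrict_apply measurableSet_Iic]
  change ∫⁻ v in Icc (0 : ℝ) 1, volume.restrict (Icc (0 : ℝ) 1) {w | stochInvDeriv V v w ≤ a} = _
  rcases lt_or_ge a 0 with h0 | h0
  · have h1 : Iic a ∩ Icc (0 : ℝ) 1 = ∅ := by
      ext x
      simp only [mem_inter_iff, mem_Iic, mem_Icc, mem_empty_iff_false, iff_false]
      intro hx
      linarith [hx.1, hx.2.1]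
    have h2 : ∀ v ∈ Icc (0 : ℝ) 1,
        volume.restrict (Icc (0 : ℝ) 1) {w | stochInvDeriv V v w ≤ a} = 0 := by
      intro v hv
      have hempty : {w | stochInvDeriv V v w ≤ a} = ∅ := by
        ext w
        simpa using h0.trans_le (h.stochInvDeriv_mem hv w).1
      rw [hempty, measure_empty]
    rw [setLIntegral_congr_fun measurableSet_Icc h2, h1]
    simp
  rcases lt_or_ge 1 a with h1 | h1
  · have h2 : Iic a ∩ Icc (0 : ℝ) 1 = Icc 0 1 :=
      inter_eq_right.2 fun x hx => hx.2.trans h1.le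
    have h3 : ∀ v ∈ Icc (0 : ℝ) 1,
        volume.restrict (Icc (0 : ℝ) 1) {w | stochInvDeriv V v w ≤ a} = 1 := by
      intro v hv
      convert! measure_univ (μ := volume.restrict (Icc (0 : ℝ) 1)) using 2
      ext w
      simpa using (h.stochInvDeriv_mem hv w).2.trans h1.le
    rw [setLIntegral_congr_fun measurableSet_Icc h3, h2]
    simp
  have h2 : Iic a ∩ Icc (0 : ℝ) 1 = Icc 0 a := by
    ext x
    simp only [mem_inter_iff, mem_Iic, mem_Icc]
    exact ⟨fun hx => ⟨hx.2.1, hx.1⟩, fun hx => ⟨hx.2, hx.1, hx.2.trans h1⟩⟩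
  rw [h2, Real.volume_Icc, sub_zero]
  rcases lt_or_ge a δ with h3 | h3
  · exact h.lintegral_slice_of_lt h0 h3
  · exact h.lintegral_slice_of_ge h3 h1

end HasVShape

/-! ### The Gaussian copula -/

theorem stdNormalCDF_mem (x : ℝ) : stdNormalCDF x ∈ Ioo (0 : ℝ) 1 :=
  cdf_mem_Ioo strictMono_stdNormalCDF x

/-- Outside `(0, 1)` the set in `quantile` is all of `ℝ` or empty, and the real `sInf` of either is
`0`; hence the quantile is the inverse of `stdNormalCDF` extended by `0`. -/
theorem measurable_quantile_stdNormalCDF : Measurable (quantile stdNormalCDF) := by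
  have hν : gaussianReal 0 1 ≪ volume := gaussianReal_absolutelyContinuous 0 one_ne_zero
  have hemb : MeasurableEmbedding stdNormalCDF :=
    (continuous_cdf_of_absolutelyContinuous hν).measurableEmbedding
      strictMono_stdNormalCDF.injective
  have heq : quantile stdNormalCDF = Function.extend stdNormalCDF id fun _ => 0 := by
    ext u
    by_cases hu : ∃ x, stdNormalCDF x = u
    · obtain ⟨x, rfl⟩ := hu
      rw [quantile_apply strictMono_stdNormalCDF, strictMono_stdNormalCDF.injective.extend_apply,
        id]
    · rw [Function.extend_apply' _ _ _ hu, quantile]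
      rcases le_or_gt u 0 with h0 | h0
      · have : {x | u ≤ stdNormalCDF x} = univ := by
          ext x
          simpa using h0.trans (stdNormalCDF_mem x).1.le
        rw [this, Real.sInf_univ]
      · have h1 : 1 ≤ u := not_lt.1 fun h1 => hu (exists_cdf_eq hν ⟨h0, h1⟩)
        have : {x | u ≤ stdNormalCDF x} = ∅ := by
          ext x
          simpa using (stdNormalCDF_mem x).2.trans_le h1
        rw [this, Real.sInf_empty]
  rw [heq]
  exact hemb.measurable_extend measurable_id measurable_const

theorem measurable_gaussianCopulaDensity {k : ℕ} (R : Matrix (Fin k) (Fin k) ℝ) :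
    Measurable (gaussianCopulaDensity R) := by
  have hq := measurable_quantile_stdNormalCDF
  have h1 : Measurable fun v : Fin k → ℝ => fun i => quantile stdNormalCDF (v i) := by fun_prop
  have h2 : ∀ i, Measurable fun v : Fin k → ℝ => quantile stdNormalCDF (v i) := fun i => by
    fun_prop
  exact ((measurable_mvNormalPDF R).comp h1).div
    (Finset.measurable_fun_prod _ fun i _ => (measurable_gaussianPDFReal 0 1).comp (h2 i))

/-- A multivariate normal distribution has the Gaussian copula density with respect to the
distribution of independent standard normal variables. -/
theorem withDensity_mvNormalPDF_eq {k : ℕ} (R : Matrix (Fin k) (Fin k) ℝ) :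
    (volume.withDensity fun z => ENNReal.ofReal (mvNormalPDF R z)) =
      (Measure.pi fun _ : Fin k => gaussianReal 0 1).withDensity fun z =>
        ENNReal.ofReal (gaussianCopulaDensity R fun i => stdNormalCDF (z i)) := by
  have hΦ := measurable_stdNormalCDF
  have h1 : Measurable fun z : Fin k → ℝ => fun i => stdNormalCDF (z i) := by fun_prop
  have h2 : Measurable fun x : Fin k → ℝ => ∏ i, gaussianPDFReal 0 1 (x i) :=
    Finset.measurable_fun_prod _ fun i _ =>
      (measurable_gaussianPDFReal 0 1).comp (measurable_pi_apply i)
  have h3 : Measurable fun z : Fin k → ℝ =>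
      ENNReal.ofReal (gaussianCopulaDensity R fun i => stdNormalCDF (z i)) :=
    ENNReal.measurable_ofReal.comp ((measurable_gaussianCopulaDensity R).comp h1)
  rw [pi_gaussianReal_eq_withDensity, ← withDensity_mul _ (by fun_prop) h3]
  congr 1
  ext z
  have hpos : 0 < ∏ i, gaussianPDFReal 0 1 (z i) :=
    Finset.prod_pos fun i _ => gaussianPDFReal_pos _ _ _ one_ne_zero
  rw [Pi.mul_apply, ← ENNReal.ofReal_mul hpos.le]
  simp only [gaussianCopulaDensity, quantile_apply strictMono_stdNormalCDF]
  rw [mul_div_cancel₀ _ hpos.ne']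

/-! ### Finite-dimensional distributions of a VT-ARMA copula process -/

section FiniteDimensional

variable {Ω : Type*} [MeasurableSpace Ω] {P : Measure Ω} [IsProbabilityMeasure P]

/-- The reference case of independent coordinates. Regrouping a pair of vectors as a vector of pairs
reduces it to one coordinate. -/
theorem HasVShape.map_pi_stochInvDeriv {V : ℝ → ℝ} {δ : ℝ} (h : HasVShape V δ) (k : ℕ) :
    ((Measure.pi fun _ : Fin k => gaussianReal 0 1).prod
      (Measure.pi fun _ : Fin k => volume.restrict (Icc (0 : ℝ) 1))).map
        (fun x i => stochInvDeriv V (stdNormalCDF (x.1 i)) (x.2 i)) =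
      Measure.pi fun _ : Fin k => volume.restrict (Icc (0 : ℝ) 1) := by
  have hp : IsProbabilityMeasure (volume.restrict (Icc (0 : ℝ) 1)) := ⟨by simp⟩
  have hS := h.measurable_stochInvDeriv
  have hΦ := measurable_stdNormalCDF
  have hS' : Measurable fun x : ℝ × ℝ => stochInvDeriv V (stdNormalCDF x.1) x.2 :=
    hS.comp (f := fun x : ℝ × ℝ => (stdNormalCDF x.1, x.2)) (by fun_prop)
  have hone : ((gaussianReal 0 1).prod (volume.restrict (Icc (0 : ℝ) 1))).map
      (fun x : ℝ × ℝ => stochInvDeriv V (stdNormalCDF x.1) x.2) =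
      volume.restrict (Icc (0 : ℝ) 1) := by
    have h1 := Measure.map_prod_map (gaussianReal 0 1) (volume.restrict (Icc (0 : ℝ) 1)) hΦ
      measurable_id
    rw [map_stdNormalCDF, Measure.map_id] at h1
    conv_rhs => rw [← h.map_stochInvDeriv, h1, Measure.map_map hS (hΦ.prodMap measurable_id)]
    rfl
  have harrow := measurePreserving_arrowProdEquivProdArrow ℝ ℝ (Fin k)
    (fun _ => gaussianReal 0 1) (fun _ => volume.restrict (Icc (0 : ℝ) 1))
  have hmeas : Measurable fun (x : (Fin k → ℝ) × (Fin k → ℝ)) (i : Fin k) =>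
      stochInvDeriv V (stdNormalCDF (x.1 i)) (x.2 i) :=
    measurable_pi_lambda _ fun i =>
      hS'.comp (f := fun x : (Fin k → ℝ) × (Fin k → ℝ) => (x.1 i, x.2 i)) (by fun_prop)
  rw [← harrow.map_eq, Measure.map_map hmeas harrow.measurable]
  have hpi := Measure.pi_map_pi
    (μ := fun _ : Fin k => (gaussianReal 0 1).prod (volume.restrict (Icc (0 : ℝ) 1)))
    (f := fun _ x => stochInvDeriv V (stdNormalCDF x.1) x.2)
    (hμ := fun i => by rw [hone]; infer_instance) (fun _ => hS'.aemeasurable)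
  simp only [hone] at hpi
  exact hpi

theorem IsVTARMACopulaProcess.hasLaw {p q : ℕ} {Z : ℤ → Ω → ℝ} {V : ℝ → ℝ} {U : ℕ+ → Ω → ℝ}
    (hU : IsVTARMACopulaProcess P p q Z V U) {k : ℕ} {t : Fin k → ℕ+}
    (ht : Function.Injective t) :
    HasLaw (fun ω i => U (t i) ω)
      (volume.withDensity ((univ.pi fun _ : Fin k => Icc (0 : ℝ) 1).indicator fun u =>
        ENNReal.ofReal (gaussianCopulaDensity (corrMatrix (acf P Z) t) fun i => V (u i)))) P := by
  obtain ⟨hZ, hvar, δ, W, hV, hWm, hWlaw, hWind, hZW, hUdef⟩ := hU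
  have h := hV.hasVShape
  have hZm := hZ.1
  have hp : IsProbabilityMeasure (volume.restrict (Icc (0 : ℝ) 1)) := ⟨by simp⟩
  set R := corrMatrix (acf P Z) t with hR
  have hΦ := measurable_stdNormalCDF
  have hzm : Measurable fun ω (i : Fin k) => Z (t i : ℕ) ω := by fun_prop
  have hwm : Measurable fun ω (i : Fin k) => W (t i) ω := by fun_prop
  have hzlaw : P.map (fun ω (i : Fin k) => Z (t i : ℕ) ω) =
      (Measure.pi fun _ : Fin k => gaussianReal 0 1).withDensity fun z =>
        ENNReal.ofReal (gaussianCopulaDensity R fun i => stdNormalCDF (z i)) := by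
    rw [← withDensity_mvNormalPDF_eq]
    exact (hasLaw_mvNormalPDF (X := fun i => Z (t i : ℕ)) (hZ.hasGaussianLaw _)
      (fun i => hZ.integral_eq_zero _) (fun i j => (hZ.corrMatrix_apply hvar t i j).symm)
      (hZ.posDef_corrMatrix hvar ht)).map_eq
  have hwlaw : P.map (fun ω (i : Fin k) => W (t i) ω) =
      Measure.pi fun _ : Fin k => volume.restrict (Icc (0 : ℝ) 1) := by
    rw [(iIndepFun_iff_map_fun_eq_pi_map fun i => (hWm (t i)).aemeasurable).1 (hWind.precomp ht)]
    simp only [(hWlaw _).map_eq]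
  have hind : IndepFun (fun ω (i : Fin k) => Z (t i : ℕ) ω) (fun ω (i : Fin k) => W (t i) ω) P :=
    hZW.comp (φ := fun (x : ℕ+ → ℝ) (i : Fin k) => x (t i))
      (ψ := fun (x : ℕ+ → ℝ) (i : Fin k) => x (t i))
      (by fun_prop) (by fun_prop)
  have hjoint := hind.map_prod_eq_prod_map_map hzm.aemeasurable hwm.aemeasurable
  obtain ⟨V', hV'm, hV'⟩ := h.exists_measurable
  let H : (Fin k → ℝ) × (Fin k → ℝ) → Fin k → ℝ := fun x i =>
    stochInvDeriv V (stdNormalCDF (x.1 i)) (x.2 i)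
  let G : (Fin k → ℝ) → ENNReal := fun u =>
    ENNReal.ofReal (gaussianCopulaDensity R fun i => V' (u i))
  have hH : Measurable H := measurable_pi_lambda _ fun i =>
    h.measurable_stochInvDeriv.comp
      (f := fun x : (Fin k → ℝ) × (Fin k → ℝ) => (stdNormalCDF (x.1 i), x.2 i)) (by fun_prop)
  have hV'pi : Measurable fun (u : Fin k → ℝ) i => V' (u i) := by fun_prop
  have hG : Measurable G :=
    ENNReal.measurable_ofReal.comp ((measurable_gaussianCopulaDensity R).comp hV'pi)
  have hdens : Measurable fun z : Fin k → ℝ =>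
      ENNReal.ofReal (gaussianCopulaDensity R fun i => stdNormalCDF (z i)) := by
    have h1 : Measurable fun (z : Fin k → ℝ) i => stdNormalCDF (z i) := by fun_prop
    exact ENNReal.measurable_ofReal.comp ((measurable_gaussianCopulaDensity R).comp h1)
  have hUH : (fun ω i => U (t i) ω) =ᵐ[P]
      fun ω => H (fun i => Z (t i : ℕ) ω, fun i => W (t i) ω) := by
    -- `Φ(Z_t)` is uniform, so it almost surely avoids the null set where the Lipschitz function
    -- `vInvExt V` is not differentiable.
    have hdiff : ∀ i, ∀ᵐ ω ∂P,
        DifferentiableAt ℝ (vInvExt V) (stdNormalCDF (Z (t i : ℕ) ω)) := by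
      intro i
      have hg : HasGaussianLaw (Z (t i : ℕ)) P :=
        (hZ.hasGaussianLaw fun _ : Unit => ((t i : ℕ) : ℤ)).eval ()
      have hmap : P.map (fun ω => stdNormalCDF (Z (t i : ℕ) ω)) =
          volume.restrict (Icc (0 : ℝ) 1) := by
        rw [← map_stdNormalCDF, ← Real.toNNReal_one, ← hvar (t i : ℕ),
          ← hZ.integral_eq_zero (t i : ℕ), ← hg.map_eq_gaussianReal,
          Measure.map_map hΦ (hZm _)]
        rfl
      refine ae_of_ae_map (f := fun ω => stdNormalCDF (Z (t i : ℕ) ω))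
        (p := fun v => DifferentiableAt ℝ (vInvExt V) v) (hΦ.comp (hZm _)).aemeasurable ?_
      rw [hmap]
      exact ae_restrict_of_ae h.lipschitz_vInvExt.ae_differentiableAt
    filter_upwards [ae_all_iff.2 hdiff] with ω hω
    ext i
    rw [hUdef]
    exact h.stochInv_eq (stdNormalCDF_mem _) (hω i) _
  -- `V` undoes stochastic inversion, whichever branch was chosen, so the weight on the `Z` vector
  -- factors through `H`.
  have hGH : ∀ x : (Fin k → ℝ) × (Fin k → ℝ), G (H x) =
      ENNReal.ofReal (gaussianCopulaDensity R fun i => stdNormalCDF (x.1 i)) := by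
    intro x
    simp only [G, H]
    congr 2
    ext i
    have hmem := Ioo_subset_Icc_self (stdNormalCDF_mem (x.1 i))
    rw [hV' (h.stochInvDeriv_mem hmem _), h.apply_stochInvDeriv hmem]
  refine HasLaw.congr ⟨(hH.comp (hzm.prodMk hwm)).aemeasurable, ?_⟩ hUH
  have hcube : ((univ.pi fun _ : Fin k => Icc (0 : ℝ) 1).indicator fun u =>
        ENNReal.ofReal (gaussianCopulaDensity R fun i => V (u i))) =
      (univ.pi fun _ : Fin k => Icc (0 : ℝ) 1).indicator G := by
    refine indicator_congr fun u hu => ?_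
    simp only [G]
    congr 2
    ext i
    rw [hV' (hu i (mem_univ i))]
  rw [hcube, withDensity_indicator (MeasurableSet.univ_pi fun _ => measurableSet_Icc), volume_pi,
    Measure.restrict_pi_pi, ← h.map_pi_stochInvDeriv k]
  change P.map (H ∘ fun ω => (fun i => Z (t i : ℕ) ω, fun i => W (t i) ω)) =
    (Measure.map H _).withDensity G
  rw [← Measure.map_map hH (hzm.prodMk hwm), hjoint, hzlaw, hwlaw,
    prod_withDensity_left hdens, ← map_withDensity_comp hH hG]
  simp only [hGH]

/-- The times may repeat, and then no joint density is available. The laws are compared on a whole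
segment `1, …, N` of distinct times, where the correlation matrix is shift-invariant, and then
projected to the given times. -/
theorem IsVTARMACopulaProcess.isStrictlyStationary {p q : ℕ} {Z : ℤ → Ω → ℝ} {V : ℝ → ℝ}
    {U : ℕ+ → Ω → ℝ} (hU : IsVTARMACopulaProcess P p q Z V U) : IsStrictlyStationary P U := by
  have hmeas : ∀ t, AEMeasurable (U t) P := fun t =>
    (hU.hasLaw (t := fun _ : Fin 1 => t) (Function.injective_of_subsingleton _)).aemeasurable.eval 0
  refine ⟨hmeas, fun k t h => ?_⟩
  obtain ⟨N, hN⟩ : ∃ N : ℕ, ∀ i, (t i : ℕ) ≤ N :=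
    ⟨Finset.univ.sup fun i => (t i : ℕ), fun i =>
      Finset.le_sup (f := fun i => (t i : ℕ)) (Finset.mem_univ i)⟩
  let τ : Fin N → ℕ+ := fun j => ⟨(j : ℕ) + 1, Nat.succ_pos _⟩
  have hτ : Function.Injective τ := fun a b hab => by
    have := congrArg PNat.val hab
    simp only [τ, PNat.mk_coe] at this
    exact Fin.ext (by omega)
  have hτh : Function.Injective fun j => τ j + h := fun a b hab => hτ (add_right_cancel hab)
  let e : Fin k → Fin N := fun i => ⟨(t i : ℕ) - 1, by have := (t i).pos; have := hN i; omega⟩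
  have he : ∀ i, τ (e i) = t i := fun i => by
    apply PNat.eq
    have := (t i).pos
    simp only [τ, e, PNat.mk_coe]
    omega
  have hcorr : corrMatrix (acf P Z) (fun j => τ j + h) = corrMatrix (acf P Z) τ := by
    ext i j
    simp only [corrMatrix, Matrix.of_apply, PNat.add_coe]
    congr 2
    push_cast
    ring
  have hlaw : P.map (fun ω j => U (τ j + h) ω) = P.map (fun ω j => U (τ j) ω) := by
    rw [(hU.hasLaw hτh).map_eq, (hU.hasLaw hτ).map_eq, hcorr]
  have hsub : Measurable fun (x : Fin N → ℝ) (i : Fin k) => x (e i) := by fun_prop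
  have h1 := congrArg (Measure.map fun (x : Fin N → ℝ) (i : Fin k) => x (e i)) hlaw
  rw [AEMeasurable.map_map_of_aemeasurable hsub.aemeasurable (hU.hasLaw hτh).aemeasurable,
    AEMeasurable.map_map_of_aemeasurable hsub.aemeasurable (hU.hasLaw hτ).aemeasurable] at h1
  simpa only [Function.comp_def, he] using h1

end FiniteDimensional

end VTArma

end

theorem proposition5 {Ω : Type*} [MeasurableSpace Ω] (P : MeasureTheory.Measure Ω)
    [MeasureTheory.IsProbabilityMeasure P] (p q : ℕ) (Z : ℤ → Ω → ℝ) (V : ℝ → ℝ)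
    (U : ℕ+ → Ω → ℝ) (hU : VTArma.IsVTARMACopulaProcess P p q Z V U) :
    (∀ (k : ℕ) (t : Fin k → ℕ+), Function.Injective t →
      ((VTArma.corrMatrix (VTArma.acf P Z) t).PosDef ∧
        ∀ i, VTArma.corrMatrix (VTArma.acf P Z) t i i = 1) ∧
      ProbabilityTheory.HasLaw (fun ω i => U (t i) ω)
        (MeasureTheory.volume.withDensity
          ((Set.univ.pi fun _ : Fin k => Set.Icc (0 : ℝ) 1).indicator fun u =>
            ENNReal.ofReal (VTArma.gaussianCopulaDensity
              (VTArma.corrMatrix (VTArma.acf P Z) t) (fun i => V (u i))))) P) ∧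
    VTArma.IsStrictlyStationary P U := by
  refine ⟨fun k t ht => ⟨⟨?_, ?_⟩, hU.hasLaw ht⟩, hU.isStrictlyStationary⟩
  · exact hU.1.posDef_corrMatrix hU.2.1 ht
  · exact hU.1.corrMatrix_diag hU.2.1 t
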